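/- Let $\mathbb{D}$ be the open unit disc of $\mathbb{C}$. For $\gamma>0$ let $\mathscr{B}_\gamma$ be the space of all analytic functions $f$ on $\mathbb{D}$ with $\sup_{z\in\mathbb{D}}(1-|z|^2)^{\gamma}|f'(z)|<\infty$, equipped with the norm $\|f\|=|f(0)|+\sup_{z\in\mathbb{D}}(1-|z|^2)^{\gamma}|f'(z)|$. Let $\alpha\ge 2$ and $\beta>1$, and let $\mu$ be a positive Borel measure on $[0,1)$ with $$\int_{[0,1)}\frac{1}{(1-t)^{\beta-1}}\,d\mu(t)<\infty .$$ Let $\mathcal{I}_{\mu,\alpha}$ be the operator $$\mathcal{I}_{\mu,\alpha}(f)(z)=\int_{[0,1)}\frac{f(t)}{(1-tz)^{\alpha}}\,d\mu(t),\qquad z\in\mathbb{D},$$ with the principal branch of the power. Then: (i) $\mathcal{I}_{\mu,\alpha}$ is a bounded operator from $\mathscr{B}_{\beta}$ into $\mathscr{B}_{\alpha-1}$ if and only if $\mu$ is a $(\beta+1)$-Carleson measure, that is, there is a constant $C>0$ such that $\mu([t,1))\le C(1-t)^{\beta+1}$ for all $0\le t<1$. (ii) $\mathcal{I}_{\mu,\alpha}$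 is a compact operator from $\mathscr{B}_{\beta}$ into $\mathscr{B}_{\alpha-1}$ if and only if $\mu$ is a vanishing $(\beta+1)$-Carleson measure, that is, $\lim_{t\to1^-}\mu([t,1))/(1-t)^{\beta+1}=0$. -/

import Mathlib

open Set Filter Topology MeasureTheory

noncomputable section

/-- The open unit disc of the complex plane. -/
abbrev disc : Set ℂ := Metric.ball (0 : ℂ) 1

/-- The weighted derivative `(1 - |z|²)^α |f'(z)|` at a point of the disc. -/
def blochWeight (α : ℝ) (f : ℂ → ℂ) (z : disc) : ℝ :=
  (1 - ‖(z : ℂ)‖ ^ 2) ^ α * ‖deriv f (z : ℂ)‖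

/-- The Bloch type space, as a space of functions. A function on the disc is represented
by its extension by zero to `ℂ`, so that two elements are equal exactly when they agree on
the disc. -/
structure IsBloch (α : ℝ) (f : ℂ → ℂ) : Prop where
  holo : DifferentiableOn ℂ f disc
  bdd : BddAbove (range (blochWeight α f))
  zero_off : ∀ z, z ∉ disc → f z = 0

theorem disc_weight_pos (z : disc) : 0 < 1 - ‖(z : ℂ)‖ ^ 2 := by
  have h : ‖(z : ℂ)‖ < 1 := mem_ball_zero_iff.mp z.2
  nlinarith [norm_nonneg (z : ℂ)]

theorem blochWeight_nonneg (α : ℝ) (f : ℂ → ℂ) (z : disc) : 0 ≤ blochWeight α f z :=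
  mul_nonneg (Real.rpow_nonneg (disc_weight_pos z).le _) (norm_nonneg _)

theorem diffAt_of_disc {f : ℂ → ℂ} (h : DifferentiableOn ℂ f disc) (z : disc) :
    DifferentiableAt ℂ f z :=
  h.differentiableAt (Metric.isOpen_ball.mem_nhds z.2)

theorem blochWeight_add_le (α : ℝ) {f g : ℂ → ℂ} (hf : DifferentiableOn ℂ f disc)
    (hg : DifferentiableOn ℂ g disc) (z : disc) :
    blochWeight α (f + g) z ≤ blochWeight α f z + blochWeight α g z := by
  unfold blochWeight
  rw [deriv_add (diffAt_of_disc hf z) (diffAt_of_disc hg z), ← mul_add]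
  exact mul_le_mul_of_nonneg_left (norm_add_le _ _) (Real.rpow_nonneg (disc_weight_pos z).le _)

theorem blochWeight_smul (α : ℝ) (c : ℂ) {f : ℂ → ℂ} (hf : DifferentiableOn ℂ f disc)
    (z : disc) : blochWeight α (c • f) z = ‖c‖ * blochWeight α f z := by
  unfold blochWeight
  rw [deriv_const_smul c (diffAt_of_disc hf z), norm_smul]
  ring

/-- The Bloch type space as a linear subspace of the functions on `ℂ`. -/
def blochSubmodule (α : ℝ) : Submodule ℂ (ℂ → ℂ) where
  carrier := {f | IsBloch α f}
  zero_mem' := by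
    refine ⟨differentiableOn_const 0, ⟨0, ?_⟩, fun _ _ => rfl⟩
    rintro _ ⟨z, rfl⟩
    simp [blochWeight]
  add_mem' := by
    rintro f g hf hg
    refine ⟨hf.holo.add hg.holo, ?_, fun z hz => by
      simp [hf.zero_off z hz, hg.zero_off z hz]⟩
    obtain ⟨A, hA⟩ := hf.bdd
    obtain ⟨B, hB⟩ := hg.bdd
    refine ⟨A + B, ?_⟩
    rintro _ ⟨z, rfl⟩
    exact (blochWeight_add_le α hf.holo hg.holo z).trans
      (add_le_add (hA ⟨z, rfl⟩) (hB ⟨z, rfl⟩))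
  smul_mem' := by
    rintro c f hf
    refine ⟨hf.holo.const_smul c, ?_, fun z hz => by simp [hf.zero_off z hz]⟩
    obtain ⟨A, hA⟩ := hf.bdd
    refine ⟨‖c‖ * A, ?_⟩
    rintro _ ⟨z, rfl⟩
    rw [blochWeight_smul α c hf.holo]
    exact mul_le_mul_of_nonneg_left (hA ⟨z, rfl⟩) (norm_nonneg _)

/-- The Bloch type space `𝓑_α`: the holomorphic functions `f` on the unit disc such that
`sup (1 - |z|²)^α |f'(z)|` is finite. -/
def BlochSpace (α : ℝ) : Type := blochSubmodule α

namespace BlochSpace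

variable {α : ℝ}

instance : AddCommGroup (BlochSpace α) := inferInstanceAs (AddCommGroup (blochSubmodule α))

instance : Module ℂ (BlochSpace α) := inferInstanceAs (Module ℂ (blochSubmodule α))

instance : CoeFun (BlochSpace α) (fun _ => ℂ → ℂ) := ⟨fun f => f.1⟩

theorem isBloch (f : BlochSpace α) : IsBloch α f := f.2

/-- The norm `|f(0)| + sup (1 - |z|²)^α |f'(z)|`. -/
instance : Norm (BlochSpace α) := ⟨fun f => ‖f 0‖ + ⨆ z : disc, blochWeight α f z⟩

theorem norm_def (f : BlochSpace α) : ‖f‖ = ‖f 0‖ + ⨆ z : disc, blochWeight α f z := rfl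

theorem iSup_weight_nonneg (f : BlochSpace α) : 0 ≤ ⨆ z : disc, blochWeight α f z :=
  Real.iSup_nonneg (blochWeight_nonneg α f)

theorem eq_zero_of_norm {f : BlochSpace α} (h : ‖f‖ = 0) : f = 0 := by
  rw [norm_def] at h
  have h0 : ‖f 0‖ = 0 := by linarith [norm_nonneg (f 0), iSup_weight_nonneg f]
  have h1 : (⨆ z : disc, blochWeight α f z) = 0 := by
    linarith [norm_nonneg (f 0), iSup_weight_nonneg f]
  have hd : ∀ z ∈ disc, deriv f z = 0 := by
    intro z hz
    have hle : blochWeight α f ⟨z, hz⟩ ≤ 0 := h1 ▸ le_ciSup (isBloch f).bdd ⟨z, hz⟩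
    have hw := le_antisymm hle (blochWeight_nonneg α f _)
    unfold blochWeight at hw
    rcases mul_eq_zero.mp hw with h | h
    · exact absurd h (Real.rpow_pos_of_pos (disc_weight_pos ⟨z, hz⟩) α).ne'
    · exact norm_eq_zero.mp h
  apply Subtype.ext
  funext z
  change f z = 0
  by_cases hz : z ∈ disc
  · have := Metric.isOpen_ball.is_const_of_deriv_eq_zero
      (convex_ball (0 : ℂ) 1).isPreconnected (isBloch f).holo hd hz
      (Metric.mem_ball_self one_pos)
    rw [this]
    exact norm_eq_zero.mp h0
  · exact (isBloch f).zero_off z hz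

theorem normCore : NormedSpace.Core ℂ (BlochSpace α) where
  norm_nonneg f := add_nonneg (norm_nonneg _) (iSup_weight_nonneg f)
  norm_smul c f := by
    have h : ∀ z, blochWeight α (c • f : BlochSpace α) z = ‖c‖ * blochWeight α f z :=
      fun z => blochWeight_smul α c (isBloch f).holo z
    have h0 : (c • f : BlochSpace α) 0 = c * f 0 := rfl
    rw [norm_def, norm_def, h0, norm_mul, mul_add, Real.mul_iSup_of_nonneg (norm_nonneg c)]
    simp only [h]
  norm_triangle f g := by
    have h0 : (f + g : BlochSpace α) 0 = f 0 + g 0 := rfl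
    have h : (⨆ z : disc, blochWeight α (f + g : BlochSpace α) z) ≤
        (⨆ z : disc, blochWeight α f z) + ⨆ z : disc, blochWeight α g z := by
      refine Real.iSup_le (fun z => ?_)
        (add_nonneg (iSup_weight_nonneg f) (iSup_weight_nonneg g))
      exact (blochWeight_add_le α (isBloch f).holo (isBloch g).holo z).trans
        (add_le_add (le_ciSup (isBloch f).bdd z) (le_ciSup (isBloch g).bdd z))
    rw [norm_def, norm_def, norm_def, h0]
    linarith [norm_add_le (f 0) (g 0)]
  norm_eq_zero_iff f := by
    refine ⟨eq_zero_of_norm, ?_⟩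
    rintro rfl
    have h : ∀ z, blochWeight α (0 : BlochSpace α) z = 0 := by
      intro z
      have : ((0 : BlochSpace α) : ℂ → ℂ) = 0 := rfl
      simp [this, blochWeight]
    have h0 : (0 : BlochSpace α) 0 = 0 := rfl
    rw [norm_def, h0]
    simp [h]

instance : NormedAddCommGroup (BlochSpace α) := NormedAddCommGroup.ofCore normCore

instance : NormedSpace ℂ (BlochSpace α) := NormedSpace.ofCore normCore

end BlochSpace

/-- `T` is the integral operator `T f (z) = ∫_{[0,1)} f(t) / (1 - t z)^α dμ(t)` on the whole
of `𝓑_β`, with values in `𝓑_γ`: for every `f` in `𝓑_β` and every `z` in the disc the integral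
converges and its value is `T f (z)`. The power is the principal one; `1 - t z` has positive
real part. -/
def IsIntegralHilbert (μ : Measure (Ico (0 : ℝ) 1)) (α β γ : ℝ)
    (T : BlochSpace β → BlochSpace γ) : Prop :=
  ∀ f : BlochSpace β, ∀ z ∈ disc,
    Integrable (fun t : Ico (0 : ℝ) 1 =>
      f ((t : ℝ) : ℂ) / (1 - ((t : ℝ) : ℂ) * z) ^ (α : ℂ)) μ ∧
    T f z = ∫ t : Ico (0 : ℝ) 1, f ((t : ℝ) : ℂ) / (1 - ((t : ℝ) : ℂ) * z) ^ (α : ℂ) ∂μ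

/-- The integral operator with kernel `(1 - t z)^(-α)` is well defined and bounded from
`𝓑_β` into `𝓑_γ`. -/
def IntegralHilbertBounded (μ : Measure (Ico (0 : ℝ) 1)) (α β γ : ℝ) : Prop :=
  ∃ T : BlochSpace β →L[ℂ] BlochSpace γ, IsIntegralHilbert μ α β γ T

/-- The integral operator with kernel `(1 - t z)^(-α)` is well defined and compact from
`𝓑_β` into `𝓑_γ`. -/
def IntegralHilbertCompact (μ : Measure (Ico (0 : ℝ) 1)) (α β γ : ℝ) : Prop :=
  ∃ T : BlochSpace β →ₗ[ℂ] BlochSpace γ, IsIntegralHilbert μ α β γ T ∧ IsCompactOperator T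

/-- `μ` is an `s`-Carleson measure: `μ([t,1)) ≤ C (1-t)^s` for all `0 ≤ t < 1`. -/
def IsCarleson (s : ℝ) (μ : Measure (Ico (0 : ℝ) 1)) : Prop :=
  ∃ C : ℝ, 0 < C ∧ ∀ t : Ico (0 : ℝ) 1, μ (Ici t) ≤ ENNReal.ofReal (C * (1 - (t : ℝ)) ^ s)

/-- `μ` is a vanishing `s`-Carleson measure: `μ([t,1)) / (1-t)^s → 0` as `t → 1⁻`. -/
def IsVanishingCarleson (s : ℝ) (μ : Measure (Ico (0 : ℝ) 1)) : Prop :=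
  Tendsto (fun t : ℝ => μ {x | t ≤ (x : ℝ)} / ENNReal.ofReal ((1 - t) ^ s)) (𝓝[<] 1) (𝓝 0)

end

/-! Both equivalences rest on one upper and one lower estimate for the derivative of the transform,
namely `α ∫ t f(t) (1 - t z)^(-α-1) dμ(t)`.

Upper estimate. Integrating the derivative along the radius gives `|f(t)| ≤ C ‖f‖ (1-t)^(1-β)`
(`norm_ofReal_apply_le`). If `μ` is `(β+1)`-Carleson with constant `K`, a dyadic decomposition of
`[0,1)` around the scale `1-|z|` bounds the integral by a multiple of `K (1-|z|)^(1-α)`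
(`lintegral_kernel_le`), which the weight of `𝓑_(α-1)` absorbs. This gives boundedness. For
compactness the integral is split at `r`: past `r` the vanishing condition makes `K` small, and
before `r` it is enough that `f` is uniformly small on `[0,r]`, which a Montel argument supplies
(`exists_limit_of_ultrafilter`).

Lower estimate. For `f_a(z) = (1-a)/(1-az)^β`, a bounded family, the derivative of the transform at
the real point `a` is the integral of a nonnegative function; keeping only `[a,1)` gives `μ([a,1)) ≤
C ‖T f_a‖ (1-a)^(β+1)` (`IsIntegralHilbert.measure_tail_le`). Boundedness of `T` makes `μ` Carleson.
As `a → 1` the `f_a` tend to `0` pointwise on the radius, so a compact `T` has `‖T f_a‖ → 0`, which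
is the vanishing condition. -/

noncomputable section

/-! ### Bloch functions: growth, point evaluations and normal families. -/

namespace BlochSpace

theorem ext_disc {γ : ℝ} {f g : BlochSpace γ} (h : ∀ z ∈ disc, f z = g z) : f = g := by
  apply Subtype.ext
  funext z
  by_cases hz : z ∈ disc
  · exact h z hz
  · exact ((isBloch f).zero_off z hz).trans ((isBloch g).zero_off z hz).symm

theorem weight_le_norm {γ : ℝ} (f : BlochSpace γ) {z : ℂ} (hz : z ∈ disc) :
    (1 - ‖z‖ ^ 2) ^ γ * ‖deriv f z‖ ≤ ‖f‖ := by
  rw [norm_def]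
  have h : (1 - ‖z‖ ^ 2) ^ γ * ‖deriv f z‖ ≤ ⨆ w : disc, blochWeight γ f w :=
    le_ciSup (isBloch f).bdd ⟨z, hz⟩
  linarith [norm_nonneg (f 0)]

theorem norm_apply_zero_le {γ : ℝ} (f : BlochSpace γ) : ‖f 0‖ ≤ ‖f‖ := by
  rw [norm_def]
  linarith [iSup_weight_nonneg f]

theorem norm_le_of_weight_le {γ A M : ℝ} (f : BlochSpace γ) (hA : ‖f 0‖ ≤ A)
    (h : ∀ z ∈ disc, (1 - ‖z‖ ^ 2) ^ γ * ‖deriv f z‖ ≤ M) : ‖f‖ ≤ A + M := by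
  rw [norm_def]
  have : Nonempty disc := ⟨⟨0, Metric.mem_ball_self one_pos⟩⟩
  exact add_le_add hA (ciSup_le fun z => h z z.2)

theorem exists_of_differentiableOn {γ M : ℝ} {g : ℂ → ℂ} (hg : DifferentiableOn ℂ g disc)
    (h : ∀ z ∈ disc, (1 - ‖z‖ ^ 2) ^ γ * ‖deriv g z‖ ≤ M) :
    ∃ f : BlochSpace γ, (∀ z ∈ disc, f z = g z) ∧ ‖f‖ ≤ ‖g 0‖ + M := by
  have heq : EqOn (disc.indicator g) g disc := fun z hz => indicator_of_mem hz g
  have hd : ∀ z ∈ disc, deriv (disc.indicator g) z = deriv g z := fun z hz =>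
    (heq.eventuallyEq_of_mem (Metric.isOpen_ball.mem_nhds hz)).deriv_eq
  have hb : IsBloch γ (disc.indicator g) := by
    refine ⟨hg.congr heq, ⟨M, ?_⟩, fun z hz => indicator_of_notMem hz g⟩
    rintro _ ⟨z, rfl⟩
    simp only [blochWeight, hd z z.2]
    exact h z z.2
  refine ⟨⟨_, hb⟩, heq, norm_le_of_weight_le _ ?_ ?_⟩
  · exact (congrArg norm (heq (Metric.mem_ball_self one_pos))).le
  · intro z hz
    change (1 - ‖z‖ ^ 2) ^ γ * ‖deriv (disc.indicator g) z‖ ≤ M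
    rw [hd z hz]
    exact h z hz

theorem norm_deriv_le {γ : ℝ} (hγ : 0 ≤ γ) (f : BlochSpace γ) {r : ℝ} (hr : r < 1) {z : ℂ}
    (hz : ‖z‖ ≤ r) : ‖deriv f z‖ ≤ ‖f‖ * (1 - r) ^ (-γ) := by
  have hz1 : z ∈ disc := mem_ball_zero_iff.mpr (hz.trans_lt hr)
  have h := weight_le_norm f hz1
  have h1 : 1 - r ≤ 1 - ‖z‖ ^ 2 := by nlinarith [norm_nonneg z]
  have h2 : (1 - r) ^ γ * ‖deriv f z‖ ≤ ‖f‖ :=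
    le_trans (mul_le_mul_of_nonneg_right (Real.rpow_le_rpow (by linarith) h1 hγ)
      (norm_nonneg _)) h
  rw [Real.rpow_neg (by linarith), ← div_eq_mul_inv,
    le_div_iff₀ (Real.rpow_pos_of_pos (by linarith) _), mul_comm]
  exact h2

theorem norm_apply_sub_le {γ : ℝ} (hγ : 0 ≤ γ) (f : BlochSpace γ) {r : ℝ} (hr : r < 1) {z w : ℂ}
    (hz : ‖z‖ ≤ r) (hw : ‖w‖ ≤ r) : ‖f z - f w‖ ≤ ‖f‖ * (1 - r) ^ (-γ) * ‖z - w‖ := by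
  refine Convex.norm_image_sub_le_of_norm_deriv_le (s := Metric.closedBall 0 r)
    (fun x hx => ?_) (fun x hx => norm_deriv_le hγ f hr (by simpa using hx))
    (convex_closedBall 0 r) (by simpa using hw) (by simpa using hz)
  refine diffAt_of_disc (isBloch f).holo ⟨x, ?_⟩
  exact Metric.closedBall_subset_ball hr hx

theorem norm_apply_le {γ : ℝ} (hγ : 0 ≤ γ) (f : BlochSpace γ) {r : ℝ} (hr : r < 1) {z : ℂ}
    (hz : ‖z‖ ≤ r) : ‖f z‖ ≤ ‖f‖ * (1 + (1 - r) ^ (-γ)) := by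
  have h0 : 0 ≤ r := (norm_nonneg z).trans hz
  have h := norm_apply_sub_le hγ f hr hz (w := 0) (by simpa using h0)
  have h1 : ‖f z‖ ≤ ‖f z - f 0‖ + ‖f 0‖ := by simpa using norm_add_le (f z - f 0) (f 0)
  have h2 := norm_apply_zero_le f
  have h3 : 0 ≤ ‖f‖ * (1 - r) ^ (-γ) := by
    have := Real.rpow_nonneg (show 0 ≤ 1 - r by linarith) (-γ)
    positivity
  rw [sub_zero] at h
  nlinarith

/-- The bound `‖f‖ (1-x)^(-β)` on the derivative is integrated over `[0,t]`. Since `β > 1`, the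
primitive grows like `(1-t)^(1-β)`, and this power is at least `1`, so it also absorbs `|f(0)|`. -/
theorem norm_ofReal_apply_le {β : ℝ} (hβ : 1 < β) (f : BlochSpace β) {t : ℝ} (h0 : 0 ≤ t)
    (h1 : t < 1) :
    ‖f (t : ℂ)‖ ≤ (1 + 1 / (β - 1)) * ‖f‖ * (1 - t) ^ (1 - β) := by
  have hβ' : 0 < β - 1 := by linarith
  have hmem : ∀ x ∈ Icc 0 t, (x : ℂ) ∈ disc := fun x hx => by
    rw [mem_ball_zero_iff, Complex.norm_real, Real.norm_of_nonneg hx.1]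
    exact hx.2.trans_lt h1
  have hderiv : ∀ x ∈ Icc 0 t, HasDerivAt (fun y : ℝ => f (y : ℂ)) (deriv f (x : ℂ)) x :=
    fun x hx => (diffAt_of_disc (isBloch f).holo ⟨x, hmem x hx⟩).hasDerivAt.comp_ofReal
  have hB : ∀ x ∈ Icc 0 t, HasDerivAt
      (fun y : ℝ => ‖f‖ + ‖f‖ / (β - 1) * ((1 - y) ^ (1 - β) - 1))
      (‖f‖ * (1 - x) ^ (-β)) x := by
    intro x hx
    have h1x : 1 - x ≠ 0 := by linarith [hx.2]
    have := (((hasDerivAt_id x).const_sub 1).rpow_const (p := 1 - β) (Or.inl h1x))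
    refine (((this.sub_const 1).const_mul (‖f‖ / (β - 1))).const_add ‖f‖).congr_deriv ?_
    simp only [id]
    rw [show 1 - β - 1 = -β by ring]
    field_simp
    ring
  have key := image_norm_le_of_norm_deriv_right_le_deriv_boundary' (a := 0) (b := t)
    (f := fun y : ℝ => f (y : ℂ)) (f' := fun x => deriv f (x : ℂ))
    (fun x hx => (hderiv x hx).continuousAt.continuousWithinAt)
    (fun x hx => (hderiv x (Ico_subset_Icc_self hx)).hasDerivWithinAt)
    (by simpa using norm_apply_zero_le f)
    (fun x hx => (hB x hx).continuousAt.continuousWithinAt)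
    (fun x hx => (hB x (Ico_subset_Icc_self hx)).hasDerivWithinAt)
    (fun x hx => norm_deriv_le (by linarith) f (hx.2.trans h1)
      (by rw [Complex.norm_real, Real.norm_of_nonneg hx.1])) (right_mem_Icc.mpr h0)
  refine key.trans ?_
  have hone : 1 ≤ (1 - t) ^ (1 - β) :=
    Real.one_le_rpow_of_pos_of_le_one_of_nonpos (by linarith) (by linarith) (by linarith)
  have h5 : 0 ≤ ‖f‖ / (β - 1) := by positivity
  have h6 : (1 + 1 / (β - 1)) * ‖f‖ * (1 - t) ^ (1 - β) =
    ‖f‖ * (1 - t) ^ (1 - β) + ‖f‖ / (β - 1) * (1 - t) ^ (1 - β) := by ring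
  rw [h6]
  nlinarith [norm_nonneg f]

theorem continuous_apply {γ : ℝ} (hγ : 0 ≤ γ) {z : ℂ} (hz : z ∈ disc) :
    Continuous fun f : BlochSpace γ => f z := by
  let e : BlochSpace γ →ₗ[ℂ] ℂ :=
    { toFun := fun f => f z, map_add' := fun _ _ => rfl, map_smul' := fun _ _ => rfl }
  refine (LinearMap.mkContinuous e (1 + (1 - ‖z‖) ^ (-γ)) fun f => ?_).continuous
  rw [mul_comm]
  exact norm_apply_le hγ f (mem_ball_zero_iff.mp hz) le_rfl

/-- A Montel property: bounded families have locally uniform limits in the same ball. -/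
theorem exists_limit_of_ultrafilter {γ : ℝ} (hγ : 0 ≤ γ) (U : Ultrafilter (BlochSpace γ)) {M : ℝ}
    (hU : ∀ᶠ f in (U : Filter (BlochSpace γ)), ‖f‖ ≤ M) :
    ∃ g : BlochSpace γ, ‖g‖ ≤ M ∧
      TendstoLocallyUniformlyOn (fun (f : BlochSpace γ) z => f z) g U disc := by
  -- Values at a fixed point stay in a compact disc of `ℂ`, so the ultrafilter converges there
  -- without passing to subsequences.
  have hpt : ∀ z : ℂ, ∃ w : ℂ, z ∈ disc →
      Tendsto (fun f : BlochSpace γ => f z) U (𝓝 w) := by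
    intro z
    by_cases hz : z ∈ disc
    swap
    · exact ⟨0, fun h => absurd h hz⟩
    have hz1 := mem_ball_zero_iff.mp hz
    have hc := isCompact_closedBall (0 : ℂ) (M * (1 + (1 - ‖z‖) ^ (-γ)))
    obtain ⟨w, -, hw⟩ := hc.ultrafilter_le_nhds (U.map fun f => f z) (by
      rw [le_principal_iff]
      change ∀ᶠ f in (U : Filter (BlochSpace γ)), f z ∈ _
      filter_upwards [hU] with f hf
      rw [mem_closedBall_zero_iff]
      refine (norm_apply_le hγ f hz1 le_rfl).trans (mul_le_mul_of_nonneg_right hf ?_)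
      have := Real.rpow_nonneg (show 0 ≤ 1 - ‖z‖ by linarith) (-γ)
      linarith)
    exact ⟨w, fun _ => hw⟩
  choose g hg using hpt
  have hK : ∀ K ⊆ disc, IsCompact K →
      TendstoUniformlyOn (fun (f : BlochSpace γ) z => f z) g U K := by
    intro K hK hKc
    obtain ⟨r, hr, hKr⟩ : ∃ r < 1, ∀ z ∈ K, ‖z‖ ≤ r := by
      rcases K.eq_empty_or_nonempty with rfl | hne
      · exact ⟨0, by norm_num, by simp⟩
      · obtain ⟨w, hw, hmax⟩ := hKc.exists_isMaxOn hne continuous_norm.continuousOn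
        exact ⟨‖w‖, mem_ball_zero_iff.mp (hK hw), fun z hz => hmax hz⟩
    set L := M * (1 - r) ^ (-γ)
    have hLip : ∀ f : BlochSpace γ, ‖f‖ ≤ M → ∀ z ∈ K, ∀ w ∈ K,
        ‖f z - f w‖ ≤ L * ‖z - w‖ := fun f hf z hz w hw =>
      (norm_apply_sub_le hγ f hr (hKr z hz) (hKr w hw)).trans
        (mul_le_mul_of_nonneg_right (mul_le_mul_of_nonneg_right hf
          (Real.rpow_nonneg (by linarith) _)) (norm_nonneg _))
    have hgLip : ∀ z ∈ K, ∀ w ∈ K, ‖g z - g w‖ ≤ L * ‖z - w‖ := fun z hz w hw =>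
      le_of_tendsto ((hg z (hK hz)).sub (hg w (hK hw))).norm
        (hU.mono fun f hf => hLip f hf z hz w hw)
    rw [Metric.tendstoUniformlyOn_iff]
    intro ε hε
    -- Equicontinuity: pointwise convergence on a finite `δ`-net of `K` becomes uniform. The form
    -- `|L| + 1` is positive whatever the sign of `M`.
    have hδ : 0 < ε / (3 * (|L| + 1)) := by positivity
    obtain ⟨s, hsK, hsf, hcov⟩ := hKc.finite_cover_balls hδ
    have hev : ∀ᶠ f : BlochSpace γ in (U : Filter (BlochSpace γ)),
        ∀ y ∈ s, ‖f y - g y‖ < ε / 3 := by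
      refine (eventually_all_finite hsf).mpr fun y hy => ?_
      have := Metric.tendsto_nhds.mp (hg y (hK (hsK hy))) (ε / 3) (by positivity)
      simpa only [dist_eq_norm] using this
    filter_upwards [hev, hU] with f hf hfM z hz
    obtain ⟨y, hy, hzy⟩ := mem_iUnion₂.mp (hcov hz)
    rw [Metric.mem_ball, dist_eq_norm] at hzy
    have hLd : L * ‖z - y‖ ≤ ε / 3 := by
      have h1 : L * ‖z - y‖ ≤ (|L| + 1) * (ε / (3 * (|L| + 1))) :=
        mul_le_mul (by linarith [le_abs_self L]) hzy.le (norm_nonneg _) (by positivity)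
      have h2 : (|L| + 1) * (ε / (3 * (|L| + 1))) = ε / 3 := by field_simp
      linarith
    have h1 := hLip f hfM z hz y (hsK hy)
    have h2 := hgLip z hz y (hsK hy)
    have h3 := hf y hy
    rw [dist_eq_norm]
    have h4 : g z - f z = (g z - g y) - (f y - g y) - (f z - f y) := by ring
    rw [h4]
    linarith [norm_sub_le (g z - g y - (f y - g y)) (f z - f y),
      norm_sub_le (g z - g y) (f y - g y)]
  have hloc : TendstoLocallyUniformlyOn (fun (f : BlochSpace γ) z => f z) g U disc :=
    (tendstoLocallyUniformlyOn_iff_forall_isCompact Metric.isOpen_ball).mpr hK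
  have hhol : ∀ᶠ f in (U : Filter (BlochSpace γ)), DifferentiableOn ℂ (fun z => f z) disc :=
    Eventually.of_forall fun f => (isBloch f).holo
  have hder := hloc.deriv hhol Metric.isOpen_ball
  have h0 : (0 : ℂ) ∈ disc := Metric.mem_ball_self one_pos
  -- Subtracting `‖g 0‖` keeps the same constant `M` for the limit, so that closed balls contain
  -- their limits.
  have hw : ∀ z ∈ disc, (1 - ‖z‖ ^ 2) ^ γ * ‖deriv g z‖ ≤ M - ‖g 0‖ := by
    intro z hz
    refine le_of_tendsto_of_tendsto ((hder.tendsto_at hz).norm.const_mul _)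
      (tendsto_const_nhds.sub (hg 0 h0).norm) (hU.mono fun f hf => ?_)
    have h : (1 - ‖z‖ ^ 2) ^ γ * ‖deriv f z‖ ≤ ⨆ w : disc, blochWeight γ f w :=
      le_ciSup (isBloch f).bdd ⟨z, hz⟩
    rw [norm_def] at hf
    exact h.trans (by linarith)
  obtain ⟨f, hf, hfM⟩ := exists_of_differentiableOn (hloc.differentiableOn hhol
    Metric.isOpen_ball) hw
  exact ⟨f, by linarith, hloc.congr_right fun z hz => (hf z hz).symm⟩

end BlochSpace
-- Dyadic estimates for Carleson measures.
-- Values `u > 1` are allowed because the outer dyadic shells may overshoot the interval; there the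
-- total mass bound `K` suffices.
theorem measure_tail_le {s K : ℝ} {μ : Measure (Ico (0 : ℝ) 1)} (hs : 0 ≤ s) (hK0 : 0 ≤ K)
    (hK : ∀ t : Ico (0 : ℝ) 1, μ (Ici t) ≤ ENNReal.ofReal (K * (1 - (t : ℝ)) ^ s)) {u : ℝ}
    (hu : 0 < u) :
    μ {t : Ico (0 : ℝ) 1 | 1 - (t : ℝ) ≤ u} ≤ ENNReal.ofReal (K * u ^ s) := by
  rcases le_or_gt u 1 with h | h
  · have := hK ⟨1 - u, by linarith, by linarith⟩
    simp only [sub_sub_cancel] at this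
    refine le_trans (measure_mono ?_) this
    intro t ht
    have ht' : 1 - (t : ℝ) ≤ u := ht
    change 1 - u ≤ (t : ℝ)
    linarith
  · have := hK ⟨0, le_rfl, one_pos⟩
    refine (measure_mono fun t _ => ?_).trans (this.trans (ENNReal.ofReal_le_ofReal ?_))
    · exact t.2.1
    · refine mul_le_mul_of_nonneg_left ?_ hK0
      simpa using Real.one_le_rpow h.le hs

theorem setLIntegral_le_of_le {X : Type*} [MeasurableSpace X] {μ : Measure X} {s t : Set X}
    {f : X → ℝ} {a b : ℝ} (ha : 0 ≤ a) (hf : ∀ x ∈ s, f x ≤ a) (hst : s ⊆ t)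
    (ht : μ t ≤ ENNReal.ofReal b) :
    ∫⁻ x in s, ENNReal.ofReal (f x) ∂μ ≤ ENNReal.ofReal (a * b) := by
  calc ∫⁻ x in s, ENNReal.ofReal (f x) ∂μ ≤ ∫⁻ _ in s, ENNReal.ofReal a ∂μ :=
        setLIntegral_mono measurable_const fun x hx => ENNReal.ofReal_le_ofReal (hf x hx)
    _ = ENNReal.ofReal a * μ s := setLIntegral_const _ _
    _ ≤ ENNReal.ofReal a * ENNReal.ofReal b := by gcongr; exact (measure_mono hst).trans ht
    _ = ENNReal.ofReal (a * b) := (ENNReal.ofReal_mul ha).symm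

theorem lintegral_iUnion_geometric_le {X : Type*} [MeasurableSpace X] {μ : Measure X}
    {s : ℕ → Set X} {f : X → ENNReal} {c : ℝ} (hc : 0 ≤ c)
    (h : ∀ n, ∫⁻ x in s n, f x ∂μ ≤ ENNReal.ofReal (c * (1 / 2) ^ n)) :
    ∫⁻ x in ⋃ n, s n, f x ∂μ ≤ ENNReal.ofReal (2 * c) := by
  refine (lintegral_iUnion_le s f).trans ((ENNReal.tsum_le_tsum h).trans ?_)
  rw [← ENNReal.ofReal_tsum_of_nonneg (fun n => by positivity)
    (summable_geometric_two.mul_left c), tsum_mul_left, tsum_geometric_two, mul_comm]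

theorem exists_dyadic_le {u s : ℝ} (hu : 0 < u) (hus : u ≤ s) :
    ∃ n : ℕ, s * (1 / 2) ^ (n + 1) < u ∧ u ≤ s * (1 / 2) ^ n := by
  have hs : 0 < s := hu.trans_le hus
  obtain ⟨n, h1, h2⟩ := exists_nat_pow_near_of_lt_one (x := u / s) (y := 1 / 2) (by positivity)
    ((div_le_one hs).mpr hus) (by norm_num) (by norm_num)
  refine ⟨n, ?_, ?_⟩
  · rwa [lt_div_iff₀ hs, mul_comm] at h1
  · rwa [div_le_iff₀ hs, mul_comm] at h2

theorem exists_dyadic_ge {u s : ℝ} (hs : 0 < s) (hus : s ≤ u) :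
    ∃ n : ℕ, s * 2 ^ n ≤ u ∧ u < s * 2 ^ (n + 1) := by
  obtain ⟨n, h1, h2⟩ := exists_nat_pow_near (x := u / s) (y := 2) ((one_le_div hs).mpr hus)
    (by norm_num)
  refine ⟨n, ?_, ?_⟩
  · rwa [le_div_iff₀ hs, mul_comm] at h1
  · rwa [div_lt_iff₀ hs, mul_comm] at h2

/-- The Forelli–Rudin type estimate for Carleson measures on the radius. -/
theorem lintegral_kernel_le {α β K : ℝ} (hα : 2 ≤ α) (hβ : 1 < β) (hK0 : 0 ≤ K)
    {μ : Measure (Ico (0 : ℝ) 1)}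
    (hK : ∀ t : Ico (0 : ℝ) 1, μ (Ici t) ≤ ENNReal.ofReal (K * (1 - (t : ℝ)) ^ (β + 1)))
    {x : ℝ} (hx0 : 0 ≤ x) (hx1 : x < 1) :
    ∫⁻ t : Ico (0 : ℝ) 1, ENNReal.ofReal
        ((1 - (t : ℝ)) ^ (1 - β) * (1 - (t : ℝ) * x) ^ (-α - 1)) ∂μ ≤
      ENNReal.ofReal (2 ^ (β + 3) * K * (1 - x) ^ (1 - α)) := by
  set s := 1 - x with hs
  have hs0 : 0 < s := by linarith
  have hS : 0 < s ^ (1 - α) := Real.rpow_pos_of_pos hs0 _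
  set F : Ico (0 : ℝ) 1 → ℝ := fun t =>
    (1 - (t : ℝ)) ^ (1 - β) * (1 - (t : ℝ) * x) ^ (-α - 1)
  let E : ℕ → Set (Ico (0 : ℝ) 1) := fun n =>
    {t | s * (1 / 2) ^ (n + 1) < 1 - (t : ℝ) ∧ 1 - (t : ℝ) ≤ s * (1 / 2) ^ n}
  let G : ℕ → Set (Ico (0 : ℝ) 1) := fun n =>
    {t | s * 2 ^ n ≤ 1 - (t : ℝ) ∧ 1 - (t : ℝ) < s * 2 ^ (n + 1)}
  have hk1 : ∀ t : Ico (0 : ℝ) 1, s ≤ 1 - (t : ℝ) * x := fun t => by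
    nlinarith [t.2.1, t.2.2]
  have hk2 : ∀ t : Ico (0 : ℝ) 1, 1 - (t : ℝ) ≤ 1 - (t : ℝ) * x := fun t => by
    nlinarith [t.2.1, t.2.2]
  have hpos : ∀ t : Ico (0 : ℝ) 1, 0 < 1 - (t : ℝ) := fun t => by linarith [t.2.2]
  -- Shells closer to `1` than `s`: the kernel is at most `s^(-α-1)`, and the growth factor times
  -- the mass leaves `m^2 ≤ m` with `m = 2^(-n)`.
  have hEb : ∀ n, ∫⁻ t in E n, ENNReal.ofReal (F t) ∂μ ≤
      ENNReal.ofReal (2 ^ (β + 1) * K * s ^ (1 - α) * (1 / 2) ^ n) := by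
    intro n
    set m : ℝ := (1 / 2) ^ n with hm
    have hm0 : 0 < m := by positivity
    have hm1 : m ≤ 1 := pow_le_one₀ (by norm_num) (by norm_num)
    refine (setLIntegral_le_of_le (a := (s * m / 2) ^ (1 - β) * s ^ (-α - 1)) (by positivity)
      (fun t ht => ?_) (fun t ht => ht.2)
      (measure_tail_le (by linarith) hK0 hK (by positivity : 0 < s * m))).trans
      (ENNReal.ofReal_le_ofReal ?_)
    · have h1 : s * m / 2 ≤ 1 - (t : ℝ) := by
        have := ht.1
        rw [pow_succ] at this
        linarith
      exact mul_le_mul (Real.rpow_le_rpow_of_nonpos (by positivity) h1 (by linarith))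
        (Real.rpow_le_rpow_of_nonpos hs0 (hk1 t) (by linarith))
        (Real.rpow_nonneg (by linarith [hk1 t]) _) (by positivity)
    · have e : (s * m / 2) ^ (1 - β) * s ^ (-α - 1) * (K * (s * m) ^ (β + 1)) =
          2 ^ (β - 1) * K * s ^ (1 - α) * m ^ 2 := by
        have h2 : (2 : ℝ) ^ (β - 1) = ((2 : ℝ) ^ (1 - β))⁻¹ := by
          rw [← Real.rpow_neg (by norm_num), neg_sub]
        have h3 : s ^ (1 - α) = s ^ (1 - β) * s ^ (-α - 1) * s ^ (β + 1) := by
          rw [← Real.rpow_add hs0, ← Real.rpow_add hs0]; ring_nf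
        have h4 : m ^ 2 = m ^ (1 - β) * m ^ (β + 1) := by
          rw [← Real.rpow_add hm0, show 1 - β + (β + 1) = 2 by ring, Real.rpow_two]
        rw [h2, h3, h4, Real.div_rpow (by positivity) (by norm_num),
          Real.mul_rpow hs0.le hm0.le, Real.mul_rpow hs0.le hm0.le]
        ring
      rw [e]
      have h5 : (2 : ℝ) ^ (β - 1) ≤ 2 ^ (β + 1) :=
        Real.rpow_le_rpow_of_exponent_le (by norm_num) (by linarith)
      have h6 : m ^ 2 ≤ m := by nlinarith
      gcongr
  -- Shells farther than `s`: the kernel is at most `(1-t)^(-α-1)`, which leaves `m^(1-α)` with `m =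
  -- 2^n`; since `α ≥ 2` this is at most `2^(-n)`.
  have hGb : ∀ n, ∫⁻ t in G n, ENNReal.ofReal (F t) ∂μ ≤
      ENNReal.ofReal (2 ^ (β + 1) * K * s ^ (1 - α) * (1 / 2) ^ n) := by
    intro n
    set m : ℝ := 2 ^ n with hm
    have hm0 : 0 < m := by positivity
    have hm1 : 1 ≤ m := one_le_pow₀ (by norm_num)
    refine (setLIntegral_le_of_le (a := (s * m) ^ (1 - β) * (s * m) ^ (-α - 1)) (by positivity)
      (fun t ht => ?_) (fun t ht => ht.2.le)
      (measure_tail_le (by linarith) hK0 hK (by positivity : 0 < s * 2 ^ (n + 1)))).trans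
      (ENNReal.ofReal_le_ofReal ?_)
    · exact mul_le_mul (Real.rpow_le_rpow_of_nonpos (by positivity) ht.1 (by linarith))
        (Real.rpow_le_rpow_of_nonpos (by positivity) (ht.1.trans (hk2 t)) (by linarith))
        (Real.rpow_nonneg (by linarith [hk1 t]) _) (by positivity)
    · have e : (s * m) ^ (1 - β) * (s * m) ^ (-α - 1) * (K * (s * 2 ^ (n + 1)) ^ (β + 1)) =
          2 ^ (β + 1) * K * s ^ (1 - α) * m ^ (1 - α) := by
        have h3 : ∀ y : ℝ, 0 < y →
            y ^ (1 - α) = y ^ (1 - β) * y ^ (-α - 1) * y ^ (β + 1) := fun y hy => by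
          rw [← Real.rpow_add hy, ← Real.rpow_add hy]; ring_nf
        rw [h3 s hs0, h3 m hm0, pow_succ, ← hm, Real.mul_rpow hs0.le (by positivity),
          Real.mul_rpow hs0.le hm0.le, Real.mul_rpow hs0.le (by positivity),
          Real.mul_rpow hm0.le (by norm_num)]
        ring
      rw [e]
      have h6 : m ^ (1 - α) ≤ (1 / 2) ^ n := by
        rw [one_div, inv_pow, ← hm, ← Real.rpow_neg_one]
        exact Real.rpow_le_rpow_of_exponent_le hm1 (by linarith)
      gcongr
  have hcov : (univ : Set (Ico (0 : ℝ) 1)) = (⋃ n, E n) ∪ ⋃ n, G n := by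
    refine (eq_univ_of_forall fun t => ?_).symm
    rcases le_total (1 - (t : ℝ)) s with h | h
    · obtain ⟨n, h1, h2⟩ := exists_dyadic_le (hpos t) h
      exact Or.inl (mem_iUnion.mpr ⟨n, h1, h2⟩)
    · obtain ⟨n, h1, h2⟩ := exists_dyadic_ge hs0 h
      exact Or.inr (mem_iUnion.mpr ⟨n, h1, h2⟩)
  have hc : 0 ≤ 2 ^ (β + 1) * K * s ^ (1 - α) := by positivity
  rw [← setLIntegral_univ, hcov]
  refine (lintegral_union_le _ _ _).trans ((add_le_add
    (lintegral_iUnion_geometric_le hc hEb) (lintegral_iUnion_geometric_le hc hGb)).trans ?_)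
  rw [← ENNReal.ofReal_add (by positivity) (by positivity)]
  refine ENNReal.ofReal_le_ofReal (le_of_eq ?_)
  rw [show β + 3 = β + 1 + 2 by ring, Real.rpow_add (by norm_num) (β + 1) 2]
  norm_num
  ring

/-- The kernel estimate for densities that are small on `[0, r)` and of growth
`(1 - t)^(1 - β)` on `[r, 1)`. -/
theorem lintegral_mul_kernel_le {α β K δ M : ℝ} (hα : 2 ≤ α) (hβ : 1 < β) (hK0 : 0 ≤ K)
    (hδ : 0 ≤ δ) (hM : 0 ≤ M) {μ : Measure (Ico (0 : ℝ) 1)} [IsFiniteMeasure μ]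
    {r : Ico (0 : ℝ) 1} {g : Ico (0 : ℝ) 1 → ℝ}
    (hK : ∀ t, r ≤ t → μ (Ici t) ≤ ENNReal.ofReal (K * (1 - (t : ℝ)) ^ (β + 1)))
    (hg1 : ∀ t, t < r → g t ≤ δ) (hg2 : ∀ t, r ≤ t → g t ≤ M * (1 - (t : ℝ)) ^ (1 - β))
    {x : ℝ} (hx0 : 0 ≤ x) (hx1 : x < 1) :
    ∫⁻ t : Ico (0 : ℝ) 1, ENNReal.ofReal (g t * (1 - (t : ℝ) * x) ^ (-α - 1)) ∂μ ≤
      ENNReal.ofReal (δ * (1 - (r : ℝ)) ^ (-α - 1) * μ.real univ +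
        M * (2 ^ (β + 3) * K * (1 - x) ^ (1 - α))) := by
  have hr : 0 < 1 - (r : ℝ) := by linarith [r.2.2]
  have hk : ∀ t : Ico (0 : ℝ) 1, 0 ≤ (1 - (t : ℝ) * x) ^ (-α - 1) := fun t =>
    Real.rpow_nonneg (by nlinarith [t.2.1, t.2.2]) _
  have hx : 0 < 1 - x := by linarith
  rw [← lintegral_add_compl _ (measurableSet_Iio (a := r)), compl_Iio,
    ENNReal.ofReal_add (by positivity) (by positivity)]
  refine add_le_add ?_ ?_
  · refine setLIntegral_le_of_le (by positivity) (fun t ht => ?_) (subset_univ _)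
      (by simp)
    have h1 : 1 - (r : ℝ) ≤ 1 - (t : ℝ) * x := by
      have : (t : ℝ) < r := ht
      nlinarith [t.2.1]
    exact mul_le_mul (hg1 t ht) (Real.rpow_le_rpow_of_nonpos hr h1 (by linarith)) (hk t) hδ
  -- The measure restricted to `[r,1)` is Carleson on the whole interval with the same `K`: its tail
  -- from `t` is the tail of `μ` from `t ⊔ r`.
  · have hKr : ∀ t, μ.restrict (Ici r) (Ici t) ≤
        ENNReal.ofReal (K * (1 - (t : ℝ)) ^ (β + 1)) := by
      intro t
      rw [Measure.restrict_apply measurableSet_Ici, Ici_inter_Ici]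
      refine (hK _ le_sup_right).trans (ENNReal.ofReal_le_ofReal ?_)
      refine mul_le_mul_of_nonneg_left (Real.rpow_le_rpow ?_ ?_ (by linarith)) hK0
      · linarith [(t ⊔ r).2.2]
      · have : (t : ℝ) ≤ ((t ⊔ r : Ico (0 : ℝ) 1) : ℝ) := Subtype.coe_le_coe.mpr le_sup_left
        linarith
    have h2 := lintegral_kernel_le hα hβ hK0 hKr hx0 hx1
    rw [ENNReal.ofReal_mul hM]
    refine le_trans ?_ (mul_le_mul_right h2 (ENNReal.ofReal M))
    rw [← lintegral_const_mul' _ _ ENNReal.ofReal_ne_top]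
    refine setLIntegral_mono' measurableSet_Ici fun t ht => ?_
    rw [← ENNReal.ofReal_mul hM, ← mul_assoc]
    exact ENNReal.ofReal_le_ofReal (mul_le_mul_of_nonneg_right (hg2 t ht) (hk t))

/-! ### The kernel, its derivative and its size. -/

theorem re_one_sub_mul_pos {t : ℝ} (h0 : 0 ≤ t) (h1 : t ≤ 1) {z : ℂ} (hz : z ∈ disc) :
    0 < (1 - (t : ℂ) * z).re := by
  have h2 := (Complex.abs_re_le_norm z).trans_lt (mem_ball_zero_iff.mp hz)
  have h3 := (abs_lt.mp h2).2
  simp only [Complex.sub_re, Complex.one_re, Complex.re_ofReal_mul]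
  rcases h0.eq_or_lt with rfl | h
  · simp
  · nlinarith [mul_lt_mul_of_pos_left h3 h]

theorem one_sub_mul_norm_le {t : ℝ} (h0 : 0 ≤ t) (z : ℂ) :
    1 - t * ‖z‖ ≤ ‖1 - (t : ℂ) * z‖ := by
  have h := norm_sub_norm_le (1 : ℂ) ((t : ℂ) * z)
  rwa [norm_one, norm_mul, Complex.norm_real, Real.norm_of_nonneg h0] at h

theorem hasDerivAt_div_cpow (c : ℂ) (α : ℝ) {t : ℝ} (h0 : 0 ≤ t) (h1 : t ≤ 1) {z : ℂ}
    (hz : z ∈ disc) :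
    HasDerivAt (fun w => c / (1 - (t : ℂ) * w) ^ (α : ℂ))
      (α * t * c / (1 - (t : ℂ) * z) ^ ((α : ℂ) + 1)) z := by
  have hre := re_one_sub_mul_pos h0 h1 hz
  have hs : 1 - (t : ℂ) * z ∈ Complex.slitPlane := Or.inl hre
  have hne : 1 - (t : ℂ) * z ≠ 0 := Complex.slitPlane_ne_zero hs
  have h := ((((hasDerivAt_id z).const_mul (t : ℂ)).const_sub 1).cpow_const (c := -(α : ℂ))
    hs).const_mul c
  simp only [id] at h
  have e : (fun w => c / (1 - (t : ℂ) * w) ^ (α : ℂ)) =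
      fun w => c * (1 - (t : ℂ) * w) ^ (-(α : ℂ)) := by
    funext w
    rw [Complex.cpow_neg, div_eq_mul_inv]
  rw [e]
  refine h.congr_deriv ?_
  rw [show -(α : ℂ) - 1 = -((α : ℂ) + 1) by ring, Complex.cpow_neg]
  ring

theorem norm_div_cpow (c w : ℂ) (α : ℝ) : ‖c / w ^ (α : ℂ)‖ = ‖c‖ * ‖w‖ ^ (-α) := by
  rw [norm_div, Complex.norm_cpow_real, Real.rpow_neg (norm_nonneg _), div_eq_mul_inv]

theorem norm_div_cpow_le (c : ℂ) {α x : ℝ} (hα : 0 ≤ α) {t : ℝ} (h0 : 0 ≤ t) (h1 : t < 1)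
    {z : ℂ} (hz : ‖z‖ ≤ x) (hx : x < 1) :
    ‖c / (1 - (t : ℂ) * z) ^ (α : ℂ)‖ ≤ ‖c‖ * (1 - t * x) ^ (-α) := by
  have hx0 := (norm_nonneg z).trans hz
  rw [norm_div_cpow]
  refine mul_le_mul_of_nonneg_left (Real.rpow_le_rpow_of_nonpos (by nlinarith) ?_ (by linarith))
    (norm_nonneg _)
  refine le_trans ?_ (one_sub_mul_norm_le h0 z)
  nlinarith

theorem norm_ofReal_eq {t : ℝ} (h0 : 0 ≤ t) : ‖(t : ℂ)‖ = t := by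
  rw [Complex.norm_real, Real.norm_of_nonneg h0]

theorem ofReal_mem_disc (t : Ico (0 : ℝ) 1) : ((t : ℝ) : ℂ) ∈ disc := by
  rw [mem_ball_zero_iff, norm_ofReal_eq t.2.1]
  exact t.2.2

theorem continuous_bloch_ofReal {β : ℝ} (f : BlochSpace β) :
    Continuous fun t : Ico (0 : ℝ) 1 => f ((t : ℝ) : ℂ) :=
  (BlochSpace.isBloch f).holo.continuousOn.comp_continuous (by fun_prop) ofReal_mem_disc

theorem continuous_div_cpow {g : Ico (0 : ℝ) 1 → ℂ} (hg : Continuous g) (α : ℂ) {z : ℂ}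
    (hz : z ∈ disc) :
    Continuous fun t : Ico (0 : ℝ) 1 => g t / (1 - ((t : ℝ) : ℂ) * z) ^ α := by
  have hs : ∀ t : Ico (0 : ℝ) 1, 1 - ((t : ℝ) : ℂ) * z ∈ Complex.slitPlane := fun t =>
    Or.inl (re_one_sub_mul_pos t.2.1 t.2.2.le hz)
  refine hg.div ?_ fun t => ?_
  · exact Continuous.cpow (by fun_prop) continuous_const hs
  · exact fun h => Complex.slitPlane_ne_zero (hs t) (Complex.cpow_eq_zero_iff _ _ |>.mp h).1

/-- The integral transform with kernel `(1 - t z)^(-α)`. -/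
def integralHilbert (μ : Measure (Ico (0 : ℝ) 1)) (α : ℝ) (f : ℂ → ℂ) (z : ℂ) : ℂ :=
  ∫ t : Ico (0 : ℝ) 1, f ((t : ℝ) : ℂ) / (1 - ((t : ℝ) : ℂ) * z) ^ (α : ℂ) ∂μ

/-! ### The transform: differentiation, norm bounds and existence. -/

section Transform

variable {α β : ℝ} {μ : Measure (Ico (0 : ℝ) 1)}

theorem integrable_rpow (hμ : ∫⁻ t : Ico (0 : ℝ) 1,
      ENNReal.ofReal (1 / (1 - (t : ℝ)) ^ (β - 1)) ∂μ < ⊤) :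
    Integrable (fun t : Ico (0 : ℝ) 1 => (1 - (t : ℝ)) ^ (1 - β)) μ := by
  have hpos : ∀ t : Ico (0 : ℝ) 1, 0 < 1 - (t : ℝ) := fun t => by linarith [t.2.2]
  refine ⟨?_, ?_⟩
  · refine Continuous.aestronglyMeasurable ?_
    exact Continuous.rpow_const (by fun_prop) fun t => Or.inl (hpos t).ne'
  · rw [hasFiniteIntegral_iff_ofReal (ae_of_all _ fun t => Real.rpow_nonneg (hpos t).le _)]
    convert hμ using 5 with t
    rw [one_div, ← Real.rpow_neg (hpos t).le, neg_sub]

theorem isFiniteMeasure_of_lintegral (hβ : 1 < β) (hμ : ∫⁻ t : Ico (0 : ℝ) 1,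
      ENNReal.ofReal (1 / (1 - (t : ℝ)) ^ (β - 1)) ∂μ < ⊤) : IsFiniteMeasure μ := by
  refine ⟨lt_of_le_of_lt ?_ hμ⟩
  rw [← lintegral_one]
  refine lintegral_mono fun t => ?_
  have hpos : 0 < 1 - (t : ℝ) := by linarith [t.2.2]
  rw [← ENNReal.ofReal_one]
  refine ENNReal.ofReal_le_ofReal ((one_le_div (Real.rpow_pos_of_pos hpos _)).mpr ?_)
  exact Real.rpow_le_one hpos.le (by linarith [t.2.1]) (by linarith)

theorem integrable_bloch (hβ : 1 < β) (hμ : ∫⁻ t : Ico (0 : ℝ) 1,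
      ENNReal.ofReal (1 / (1 - (t : ℝ)) ^ (β - 1)) ∂μ < ⊤) (f : BlochSpace β) :
    Integrable (fun t : Ico (0 : ℝ) 1 => f ((t : ℝ) : ℂ)) μ :=
  Integrable.mono' ((integrable_rpow hμ).const_mul _)
    (continuous_bloch_ofReal f).aestronglyMeasurable
    (ae_of_all _ fun t => BlochSpace.norm_ofReal_apply_le hβ f t.2.1 t.2.2)

theorem integrable_div_cpow {g : Ico (0 : ℝ) 1 → ℂ} (hg : Continuous g) (hgi : Integrable g μ)
    (hα : 0 ≤ α) {z : ℂ} (hz : z ∈ disc) :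
    Integrable (fun t : Ico (0 : ℝ) 1 => g t / (1 - ((t : ℝ) : ℂ) * z) ^ (α : ℂ)) μ := by
  refine Integrable.mono' (hgi.norm.mul_const ((1 - ‖z‖) ^ (-α)))
    (continuous_div_cpow hg α hz).aestronglyMeasurable (ae_of_all _ fun t => ?_)
  have hz1 := mem_ball_zero_iff.mp hz
  refine (norm_div_cpow_le (g t) hα t.2.1 t.2.2 le_rfl hz1).trans
    (mul_le_mul_of_nonneg_left ?_ (norm_nonneg _))
  exact Real.rpow_le_rpow_of_nonpos (by linarith)
    (by nlinarith [norm_nonneg z, t.2.1, t.2.2]) (by linarith)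

/-- On a ball of radius `r < 1` containing `z` the differentiated kernel is bounded by a constant,
so a multiple of `‖f(t)‖` dominates. -/
theorem hasDerivAt_integralHilbert (hα : 0 ≤ α) {f : ℂ → ℂ}
    (hf : Continuous fun t : Ico (0 : ℝ) 1 => f ((t : ℝ) : ℂ))
    (hfi : Integrable (fun t : Ico (0 : ℝ) 1 => f ((t : ℝ) : ℂ)) μ) {z : ℂ} (hz : z ∈ disc) :
    HasDerivAt (integralHilbert μ α f)
      (∫ t : Ico (0 : ℝ) 1, α * (t : ℝ) * f ((t : ℝ) : ℂ) /
        (1 - ((t : ℝ) : ℂ) * z) ^ ((α : ℂ) + 1) ∂μ) z := by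
  have hz1 := mem_ball_zero_iff.mp hz
  obtain ⟨r, hzr, hr1⟩ := exists_between hz1
  have hsub : Metric.ball (0 : ℂ) r ⊆ disc := Metric.ball_subset_ball hr1.le
  have hr0 : 0 ≤ r := (norm_nonneg z).trans hzr.le
  have hα1 : (α : ℂ) + 1 = ((α + 1 : ℝ) : ℂ) := by push_cast; rfl
  refine (hasDerivAt_integral_of_dominated_loc_of_deriv_le (s := Metric.ball 0 r)
    (Metric.isOpen_ball.mem_nhds (mem_ball_zero_iff.mpr hzr))
    (bound := fun t : Ico (0 : ℝ) 1 => α * ‖f ((t : ℝ) : ℂ)‖ * (1 - r) ^ (-(α + 1)))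
    (F := fun w t => f ((t : ℝ) : ℂ) / (1 - ((t : ℝ) : ℂ) * w) ^ (α : ℂ))
    (F' := fun w t => α * (t : ℝ) * f ((t : ℝ) : ℂ) /
        (1 - ((t : ℝ) : ℂ) * w) ^ ((α : ℂ) + 1))
    ?_ (integrable_div_cpow hf hfi hα hz) ?_ (ae_of_all _ fun t w hw => ?_) ?_
    (ae_of_all _ fun t w hw =>
      hasDerivAt_div_cpow _ α t.2.1 t.2.2.le (hsub hw))).2
  · filter_upwards [Metric.isOpen_ball.mem_nhds hz] with w hw
    exact (continuous_div_cpow hf α hw).aestronglyMeasurable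
  · exact (continuous_div_cpow ((continuous_const.mul (by fun_prop)).mul hf) _ hz).aestronglyMeasurable
  · have hw1 := (mem_ball_zero_iff.mp hw).le
    rw [hα1]
    refine (norm_div_cpow_le _ (by linarith) t.2.1 t.2.2 hw1 hr1).trans ?_
    have h1 : (1 - (t : ℝ) * r) ^ (-(α + 1)) ≤ (1 - r) ^ (-(α + 1)) :=
      Real.rpow_le_rpow_of_nonpos (by linarith) (by nlinarith [t.2.1, t.2.2]) (by linarith)
    have h2 : ‖(α : ℂ) * (t : ℝ) * f ((t : ℝ) : ℂ)‖ ≤ α * ‖f ((t : ℝ) : ℂ)‖ := by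
      rw [norm_mul, norm_mul, norm_ofReal_eq hα, norm_ofReal_eq t.2.1]
      have := mul_nonneg hα (norm_nonneg (f ((t : ℝ) : ℂ)))
      nlinarith [t.2.2]
    have h3 : 0 ≤ 1 - (t : ℝ) * r := by nlinarith [t.2.1, t.2.2]
    exact mul_le_mul h2 h1 (Real.rpow_nonneg h3 _) (by positivity)
  · exact (hfi.norm.const_mul α).mul_const _

theorem norm_integral_le_of_lintegral_le {X E : Type*} [MeasurableSpace X] {ν : Measure X}
    [NormedAddCommGroup E] [NormedSpace ℝ E]
    {F : X → E} {g : X → ℝ} {B : ℝ} (hB : 0 ≤ B) (h : ∀ x, ‖F x‖ ≤ g x)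
    (hg : ∫⁻ x, ENNReal.ofReal (g x) ∂ν ≤ ENNReal.ofReal B) : ‖∫ x, F x ∂ν‖ ≤ B := by
  refine (norm_integral_le_lintegral_norm F).trans (ENNReal.toReal_le_of_le_ofReal hB ?_)
  exact (lintegral_mono fun x => ENNReal.ofReal_le_ofReal (h x)).trans hg

/-- The weighted derivative of the transform of a function which is at most `δ` on `[0, r)`
and of growth `(1 - t)^(1 - β)` on `[r, 1)`. -/
theorem integralHilbert_bounds {K δ M : ℝ} (hα : 2 ≤ α) (hβ : 1 < β) (hK0 : 0 ≤ K)
    (hδ : 0 ≤ δ) (hM : 0 ≤ M) [IsFiniteMeasure μ] {r : Ico (0 : ℝ) 1} {f : ℂ → ℂ}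
    (hf : Continuous fun t : Ico (0 : ℝ) 1 => f ((t : ℝ) : ℂ))
    (hfi : Integrable (fun t : Ico (0 : ℝ) 1 => f ((t : ℝ) : ℂ)) μ)
    (hK : ∀ t, r ≤ t → μ (Ici t) ≤ ENNReal.ofReal (K * (1 - (t : ℝ)) ^ (β + 1)))
    (hg1 : ∀ t : Ico (0 : ℝ) 1, t < r → ‖f ((t : ℝ) : ℂ)‖ ≤ δ)
    (hg2 : ∀ t : Ico (0 : ℝ) 1, r ≤ t → ‖f ((t : ℝ) : ℂ)‖ ≤ M * (1 - (t : ℝ)) ^ (1 - β)) :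
    ‖integralHilbert μ α f 0‖ ≤
      δ * (1 - (r : ℝ)) ^ (-α - 1) * μ.real univ + M * (2 ^ (β + 3) * K) ∧
    ∀ z ∈ disc, (1 - ‖z‖ ^ 2) ^ (α - 1) * ‖deriv (integralHilbert μ α f) z‖ ≤
      α * 2 ^ (α - 1) *
        (δ * (1 - (r : ℝ)) ^ (-α - 1) * μ.real univ + M * (2 ^ (β + 3) * K)) := by
  have hr : 0 < 1 - (r : ℝ) := by linarith [r.2.2]
  have hA : 0 ≤ δ * (1 - (r : ℝ)) ^ (-α - 1) * μ.real univ := by positivity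
  have hB : 0 ≤ M * (2 ^ (β + 3) * K) := by positivity
  have key : ∀ x : ℝ, 0 ≤ x → x < 1 → _ := fun x hx0 hx1 =>
    lintegral_mul_kernel_le (g := fun t : Ico (0 : ℝ) 1 => ‖f ((t : ℝ) : ℂ)‖)
      hα hβ hK0 hδ hM hK hg1 hg2 hx0 hx1
  constructor
  · refine norm_integral_le_of_lintegral_le (E := ℂ) (B := δ * (1 - (r : ℝ)) ^ (-α - 1) *
      μ.real univ + M * (2 ^ (β + 3) * K)) (add_nonneg hA hB) (fun t => ?_)
      ((key 0 le_rfl one_pos).trans (le_of_eq ?_)) <;> simp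
  · intro z hz
    have hz1 := mem_ball_zero_iff.mp hz
    have hx : 0 < 1 - ‖z‖ := by linarith
    have hS : 0 < (1 - ‖z‖) ^ (1 - α) := Real.rpow_pos_of_pos hx _
    rw [(hasDerivAt_integralHilbert (by linarith) hf hfi hz).deriv]
    have hα1 : (α : ℂ) + 1 = ((α + 1 : ℝ) : ℂ) := by push_cast; rfl
    have h1 : ‖∫ t : Ico (0 : ℝ) 1, α * (t : ℝ) * f ((t : ℝ) : ℂ) /
        (1 - ((t : ℝ) : ℂ) * z) ^ ((α : ℂ) + 1) ∂μ‖ ≤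
        α * (δ * (1 - (r : ℝ)) ^ (-α - 1) * μ.real univ +
          M * (2 ^ (β + 3) * K * (1 - ‖z‖) ^ (1 - α))) := by
      have hnn : 0 ≤ α * (δ * (1 - (r : ℝ)) ^ (-α - 1) * μ.real univ +
          M * (2 ^ (β + 3) * K * (1 - ‖z‖) ^ (1 - α))) := by positivity
      refine norm_integral_le_of_lintegral_le (E := ℂ) hnn
        (g := fun t : Ico (0 : ℝ) 1 => α * (‖f ((t : ℝ) : ℂ)‖ * (1 - (t : ℝ) * ‖z‖) ^ (-α - 1)))
        (fun t => ?_) ?_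
      · rw [hα1]
        refine (norm_div_cpow_le _ (by linarith) t.2.1 t.2.2 le_rfl hz1).trans ?_
        rw [norm_mul, norm_mul, norm_ofReal_eq (by linarith : 0 ≤ α), norm_ofReal_eq t.2.1,
          show -(α + 1) = -α - 1 by ring, ← mul_assoc]
        have h3 : 0 ≤ 1 - (t : ℝ) * ‖z‖ := by nlinarith [t.2.1, t.2.2, norm_nonneg z]
        refine mul_le_mul_of_nonneg_right ?_ (Real.rpow_nonneg h3 _)
        have := mul_nonneg (by linarith : 0 ≤ α) (norm_nonneg (f ((t : ℝ) : ℂ)))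
        nlinarith [t.2.2]
      · simp_rw [ENNReal.ofReal_mul (by linarith : 0 ≤ α)]
        rw [lintegral_const_mul' _ _ ENNReal.ofReal_ne_top]
        gcongr
        exact key ‖z‖ (norm_nonneg z) hz1
    -- From `1 - |z|^2 ≤ 2 (1 - |z|)`; the remaining power cancels the kernel estimate exactly.
    have h2 : (1 - ‖z‖ ^ 2) ^ (α - 1) ≤ 2 ^ (α - 1) * (1 - ‖z‖) ^ (α - 1) := by
      rw [← Real.mul_rpow (by norm_num) hx.le]
      refine Real.rpow_le_rpow ?_ ?_ (by linarith) <;> nlinarith [norm_nonneg z]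
    have h4 : (1 - ‖z‖) ^ (α - 1) * (1 - ‖z‖) ^ (1 - α) = 1 := by
      rw [← Real.rpow_add hx]
      simp
    have h5 : (1 - ‖z‖) ^ (α - 1) ≤ 1 :=
      Real.rpow_le_one hx.le (by linarith [norm_nonneg z]) (by linarith)
    refine (mul_le_mul h2 h1 (norm_nonneg _) (by positivity)).trans ?_
    set A := δ * (1 - (r : ℝ)) ^ (-α - 1) * μ.real univ
    set s := (1 - ‖z‖) ^ (α - 1)
    calc 2 ^ (α - 1) * s * (α * (A + M * (2 ^ (β + 3) * K * (1 - ‖z‖) ^ (1 - α))))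
        = α * 2 ^ (α - 1) * (s * A + M * (2 ^ (β + 3) * K) * (s * (1 - ‖z‖) ^ (1 - α))) := by
          ring
      _ ≤ α * 2 ^ (α - 1) * (A + M * (2 ^ (β + 3) * K)) := by
          rw [h4, mul_one]
          have : s * A ≤ A := mul_le_of_le_one_left hA h5
          gcongr

theorem IsIntegralHilbert.apply_eq {γ : ℝ} {T : BlochSpace β → BlochSpace γ}
    (hT : IsIntegralHilbert μ α β γ T) (f : BlochSpace β) :
    EqOn (T f) (integralHilbert μ α f) disc := fun z hz => (hT f z hz).2

theorem IsIntegralHilbert.deriv_eq {γ : ℝ} {T : BlochSpace β → BlochSpace γ}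
    (hT : IsIntegralHilbert μ α β γ T) (f : BlochSpace β) {z : ℂ} (hz : z ∈ disc) :
    deriv (T f) z = deriv (integralHilbert μ α f) z :=
  ((hT.apply_eq f).eventuallyEq_of_mem (Metric.isOpen_ball.mem_nhds hz)).deriv_eq

/-- Used with `r = 0`, where the condition on `δ` is vacuous, for boundedness, and with `r` near `1`
for compactness. -/
theorem IsIntegralHilbert.norm_le {T : BlochSpace β → BlochSpace (α - 1)}
    (hT : IsIntegralHilbert μ α β (α - 1) T) {K δ M : ℝ} (hα : 2 ≤ α) (hβ : 1 < β)
    (hμ : ∫⁻ t : Ico (0 : ℝ) 1, ENNReal.ofReal (1 / (1 - (t : ℝ)) ^ (β - 1)) ∂μ < ⊤)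
    (hK0 : 0 ≤ K) (hδ : 0 ≤ δ) (hM : 0 ≤ M) {r : Ico (0 : ℝ) 1} (f : BlochSpace β)
    (hK : ∀ t, r ≤ t → μ (Ici t) ≤ ENNReal.ofReal (K * (1 - (t : ℝ)) ^ (β + 1)))
    (hf1 : ∀ t : Ico (0 : ℝ) 1, t < r → ‖f ((t : ℝ) : ℂ)‖ ≤ δ) (hf2 : ‖f‖ ≤ M) :
    ‖T f‖ ≤ (1 + α * 2 ^ (α - 1)) * (δ * (1 - (r : ℝ)) ^ (-α - 1) * μ.real univ +
      (1 + 1 / (β - 1)) * M * (2 ^ (β + 3) * K)) := by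
  have := isFiniteMeasure_of_lintegral hβ hμ
  have hβ' : 0 < β - 1 := by linarith
  obtain ⟨h1, h2⟩ := integralHilbert_bounds hα hβ hK0 hδ
    (M := (1 + 1 / (β - 1)) * M) (by positivity) (continuous_bloch_ofReal f)
    (integrable_bloch hβ hμ f) hK hf1 (fun t _ => by
      refine (BlochSpace.norm_ofReal_apply_le hβ f t.2.1 t.2.2).trans ?_
      have : 0 ≤ (1 - (t : ℝ)) ^ (1 - β) := Real.rpow_nonneg (by linarith [t.2.2]) _
      gcongr)
  rw [add_mul, one_mul]
  refine BlochSpace.norm_le_of_weight_le _ ?_ fun z hz => ?_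
  · rwa [hT.apply_eq f (Metric.mem_ball_self one_pos)]
  · rw [hT.deriv_eq f hz]
    exact h2 z hz

theorem exists_isIntegralHilbert {K : ℝ} (hα : 2 ≤ α) (hβ : 1 < β)
    (hμ : ∫⁻ t : Ico (0 : ℝ) 1, ENNReal.ofReal (1 / (1 - (t : ℝ)) ^ (β - 1)) ∂μ < ⊤)
    (hK0 : 0 ≤ K)
    (hK : ∀ t : Ico (0 : ℝ) 1, μ (Ici t) ≤ ENNReal.ofReal (K * (1 - (t : ℝ)) ^ (β + 1))) :
    ∃ T : BlochSpace β →L[ℂ] BlochSpace (α - 1), IsIntegralHilbert μ α β (α - 1) T := by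
  have := isFiniteMeasure_of_lintegral hβ hμ
  have hβ' : 0 < β - 1 := by linarith
  have hint : ∀ (f : BlochSpace β) z, z ∈ disc → Integrable (fun t : Ico (0 : ℝ) 1 =>
      f ((t : ℝ) : ℂ) / (1 - ((t : ℝ) : ℂ) * z) ^ (α : ℂ)) μ := fun f z hz =>
    integrable_div_cpow (continuous_bloch_ofReal f) (integrable_bloch hβ hμ f) (by linarith) hz
  have hex : ∀ f : BlochSpace β, ∃ g : BlochSpace (α - 1),
      ∀ z ∈ disc, g z = integralHilbert μ α f z := by
    intro f
    have h := integralHilbert_bounds (r := ⟨0, le_rfl, one_pos⟩) (δ := 0) hα hβ hK0 le_rfl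
      (M := (1 + 1 / (β - 1)) * ‖f‖) (by positivity) (continuous_bloch_ofReal f)
      (integrable_bloch hβ hμ f) (fun t _ => hK t) (fun t ht => absurd t.2.1 (not_le.mpr ht))
      (fun t _ => BlochSpace.norm_ofReal_apply_le hβ f t.2.1 t.2.2)
    obtain ⟨g, hg, -⟩ := BlochSpace.exists_of_differentiableOn (fun z hz =>
      (hasDerivAt_integralHilbert (μ := μ) (by linarith : 0 ≤ α) (continuous_bloch_ofReal f)
        (integrable_bloch hβ hμ f) hz).differentiableAt.differentiableWithinAt) h.2
    exact ⟨g, hg⟩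
  choose T hT using hex
  have hTI : IsIntegralHilbert μ α β (α - 1) T := fun f z hz => ⟨hint f z hz, hT f z hz⟩
  let L : BlochSpace β →ₗ[ℂ] BlochSpace (α - 1) :=
    { toFun := T
      map_add' := fun f g => BlochSpace.ext_disc fun z hz => by
        change T (f + g) z = T f z + T g z
        rw [hT _ z hz, hT _ z hz, hT _ z hz, integralHilbert, integralHilbert, integralHilbert,
          ← integral_add (hint f z hz) (hint g z hz)]
        exact integral_congr_ae (ae_of_all _ fun t => add_div _ _ _)
      map_smul' := fun c f => BlochSpace.ext_disc fun z hz => by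
        change T (c • f) z = c * T f z
        rw [hT _ z hz, hT _ z hz, integralHilbert, integralHilbert, ← integral_const_mul]
        exact integral_congr_ae (ae_of_all _ fun t => mul_div_assoc _ _ _) }
  refine ⟨L.mkContinuous ((1 + α * 2 ^ (α - 1)) *
    ((1 + 1 / (β - 1)) * (2 ^ (β + 3) * K))) fun f => ?_, hTI⟩
  refine (hTI.norm_le (r := ⟨0, le_rfl, one_pos⟩) hα hβ hμ hK0 le_rfl (norm_nonneg f) f
    (fun t _ => hK t) (fun t ht => absurd t.2.1 (not_le.mpr ht)) le_rfl).trans_eq ?_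
  ring

/-! ### Test functions and the tails of the measure. -/

/-- The functions `(1 - a) / (1 - a z)^β` form a bounded family in the Bloch type space. -/
theorem exists_testFunction (hβ : 0 < β) {a : ℝ} (ha : a ∈ Ico (0 : ℝ) 1) :
    ∃ f : BlochSpace β, ‖f‖ ≤ 1 + β * 2 ^ β ∧
      ∀ z ∈ disc, f z = ((1 - a : ℝ) : ℂ) / (1 - (a : ℂ) * z) ^ (β : ℂ) := by
  have hd : ∀ z ∈ disc, _ := fun z hz =>
    hasDerivAt_div_cpow ((1 - a : ℝ) : ℂ) β ha.1 ha.2.le hz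
  have hw : ∀ z ∈ disc, (1 - ‖z‖ ^ 2) ^ β *
      ‖deriv (fun w => ((1 - a : ℝ) : ℂ) / (1 - (a : ℂ) * w) ^ (β : ℂ)) z‖ ≤ β * 2 ^ β := by
    intro z hz
    have hz1 := mem_ball_zero_iff.mp hz
    rw [(hd z hz).deriv]
    have hβ1 : (β : ℂ) + 1 = ((β + 1 : ℝ) : ℂ) := by push_cast; rfl
    have h1a : 0 < 1 - a := by linarith [ha.2]
    rw [hβ1, norm_div_cpow, norm_mul, norm_mul, norm_ofReal_eq hβ.le, norm_ofReal_eq ha.1,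
      norm_ofReal_eq h1a.le]
    have hN := one_sub_mul_norm_le ha.1 z
    set N := ‖1 - (a : ℂ) * z‖
    have hN1 : 1 - a ≤ N := by nlinarith [norm_nonneg z, ha.1]
    have hN2 : 1 - ‖z‖ ^ 2 ≤ 2 * N := by nlinarith [norm_nonneg z, ha.1, ha.2]
    have hN0 : 0 < N := by linarith
    have h1 : (1 - ‖z‖ ^ 2) ^ β ≤ 2 ^ β * N ^ β := by
      rw [← Real.mul_rpow (by norm_num) hN0.le]
      exact Real.rpow_le_rpow (by nlinarith [norm_nonneg z]) hN2 hβ.le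
    have h2 : N ^ β * N ^ (-(β + 1)) = N⁻¹ := by
      rw [← Real.rpow_add hN0, show β + -(β + 1) = -1 by ring, Real.rpow_neg_one]
    have h3 : a * ((1 - a) * N⁻¹) ≤ 1 := by
      have : (1 - a) * N⁻¹ ≤ 1 := by
        rw [← div_eq_mul_inv]
        exact (div_le_one hN0).mpr hN1
      nlinarith [ha.1, ha.2, mul_nonneg h1a.le (inv_pos.mpr hN0).le]
    calc (1 - ‖z‖ ^ 2) ^ β * (β * a * (1 - a) * N ^ (-(β + 1)))
        ≤ 2 ^ β * N ^ β * (β * a * (1 - a) * N ^ (-(β + 1))) := by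
          refine mul_le_mul_of_nonneg_right h1 ?_
          have := ha.1
          positivity
      _ = β * 2 ^ β * (a * ((1 - a) * N⁻¹)) := by
          rw [← h2]
          ring
      _ ≤ β * 2 ^ β := mul_le_of_le_one_right (by positivity) h3
  obtain ⟨f, hf, hn⟩ := BlochSpace.exists_of_differentiableOn
    (fun z hz => (hd z hz).differentiableAt.differentiableWithinAt) hw
  refine ⟨f, hn.trans (add_le_add ?_ le_rfl), hf⟩
  rw [mul_zero, sub_zero, Complex.one_cpow, div_one, norm_ofReal_eq (by linarith [ha.2])]
  linarith [ha.1]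

/-- The mass near `1` is controlled by the image of a test function. -/
theorem IsIntegralHilbert.measure_tail_le {T : BlochSpace β → BlochSpace (α - 1)}
    (hT : IsIntegralHilbert μ α β (α - 1) T) (hα : 2 ≤ α) (hβ : 1 < β)
    (hμ : ∫⁻ t : Ico (0 : ℝ) 1, ENNReal.ofReal (1 / (1 - (t : ℝ)) ^ (β - 1)) ∂μ < ⊤)
    {a : Ico (0 : ℝ) 1} (ha : 1 / 2 ≤ (a : ℝ)) {f : BlochSpace β}
    (hf : ∀ z ∈ disc, f z = ((1 - a : ℝ) : ℂ) / (1 - ((a : ℝ) : ℂ) * z) ^ (β : ℂ)) :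
    μ (Ici a) ≤ ENNReal.ofReal (2 ^ (α + β + 1) * ‖T f‖ * (1 - (a : ℝ)) ^ (β + 1)) := by
  have := isFiniteMeasure_of_lintegral hβ hμ
  have hs : 0 < 1 - (a : ℝ) := by linarith [a.2.2]
  set s := 1 - (a : ℝ)
  have hadisc := ofReal_mem_disc a
  have hα1 : (α : ℂ) + 1 = ((α + 1 : ℝ) : ℂ) := by push_cast; rfl
  have hpos : ∀ t : Ico (0 : ℝ) 1, 0 < 1 - (t : ℝ) * a := fun t => by
    nlinarith [t.2.1, t.2.2, a.2.1, a.2.2]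
  let G : Ico (0 : ℝ) 1 → ℝ := fun t => α * t * s * (1 - (t : ℝ) * a) ^ (-(α + β + 1))
  have hG0 : ∀ t, 0 ≤ G t := fun t => by
    have := t.2.1
    have := Real.rpow_nonneg (hpos t).le (-(α + β + 1))
    have : 0 ≤ α := by linarith
    positivity
  have hGeq : ∀ t : Ico (0 : ℝ) 1, (α : ℂ) * (t : ℝ) * f ((t : ℝ) : ℂ) /
      (1 - ((t : ℝ) : ℂ) * ((a : ℝ) : ℂ)) ^ ((α : ℂ) + 1) = (G t : ℂ) := by
    intro t
    have h1 : 1 - ((t : ℝ) : ℂ) * ((a : ℝ) : ℂ) = ((1 - (t : ℝ) * a : ℝ) : ℂ) := by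
      push_cast; rfl
    have h2 : (1 - (t : ℝ) * a) ^ (-(α + β + 1)) =
        ((1 - (t : ℝ) * a) ^ β)⁻¹ * ((1 - (t : ℝ) * a) ^ (α + 1))⁻¹ := by
      rw [← Real.rpow_neg (hpos t).le, ← Real.rpow_neg (hpos t).le, ← Real.rpow_add (hpos t)]
      ring_nf
    rw [hf _ (ofReal_mem_disc t), mul_comm ((a : ℝ) : ℂ), h1, hα1,
      ← Complex.ofReal_cpow (hpos t).le, ← Complex.ofReal_cpow (hpos t).le]
    simp only [G, h2]
    push_cast
    ring
  have hderiv : deriv (T f) ((a : ℝ) : ℂ) = ((∫ t, G t ∂μ : ℝ) : ℂ) := by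
    rw [hT.deriv_eq f hadisc, (hasDerivAt_integralHilbert (by linarith)
      (continuous_bloch_ofReal f) (integrable_bloch hβ hμ f) hadisc).deriv]
    exact (integral_congr_ae (ae_of_all _ hGeq)).trans integral_complex_ofReal
  have hGi : Integrable G μ := by
    have h := integrable_div_cpow (μ := μ)
      (g := fun t : Ico (0 : ℝ) 1 => (α : ℂ) * (t : ℝ) * f ((t : ℝ) : ℂ))
      ((continuous_const.mul (by fun_prop)).mul (continuous_bloch_ofReal f)) ?_
      (by linarith : 0 ≤ α + 1) hadisc
    · refine (h.norm).congr (ae_of_all _ fun t => ?_)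
      simp only [← hα1, hGeq t]
      exact norm_ofReal_eq (hG0 t)
    · refine Integrable.mono' ((integrable_bloch hβ hμ f).norm.const_mul α)
        ((continuous_const.mul (by fun_prop)).mul
          (continuous_bloch_ofReal f)).aestronglyMeasurable (ae_of_all _ fun t => ?_)
      rw [norm_mul, norm_mul, norm_ofReal_eq (by linarith : 0 ≤ α), norm_ofReal_eq t.2.1]
      have := mul_nonneg (by linarith : 0 ≤ α) (norm_nonneg (f ((t : ℝ) : ℂ)))
      nlinarith [t.2.2]
  -- For `t ≥ a` one has `1 - ta ≤ 1 - a^2 ≤ 2s`, and `αt ≥ 1` because `α ≥ 2` and `a ≥ 1/2`.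
  have hlow : μ.real (Ici a) * (s * (2 * s) ^ (-(α + β + 1))) ≤ ∫ t, G t ∂μ := by
    rw [← smul_eq_mul, ← integral_indicator_const _ measurableSet_Ici]
    refine integral_mono ((integrable_const _).indicator measurableSet_Ici) hGi fun t => ?_
    by_cases ht : t ∈ Ici a
    · rw [indicator_of_mem ht]
      have hta : (a : ℝ) ≤ t := ht
      have h1 : (2 * s) ^ (-(α + β + 1)) ≤ (1 - (t : ℝ) * a) ^ (-(α + β + 1)) := by
        refine Real.rpow_le_rpow_of_nonpos (hpos t) ?_ (by linarith)
        nlinarith [a.2.1, a.2.2]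
      have h2 : 1 ≤ α * (t : ℝ) := by nlinarith
      have h3 := Real.rpow_nonneg (by linarith : 0 ≤ 2 * s) (-(α + β + 1))
      refine mul_le_mul ?_ h1 h3 (by positivity)
      nlinarith
    · rw [indicator_of_notMem ht]
      exact hG0 t
  have hw := BlochSpace.weight_le_norm (T f) hadisc
  rw [hderiv, norm_ofReal_eq (integral_nonneg hG0), norm_ofReal_eq a.2.1] at hw
  have hw1 : s ^ (α - 1) * (μ.real (Ici a) * (s * (2 * s) ^ (-(α + β + 1)))) ≤ ‖T f‖ := by
    refine le_trans (mul_le_mul ?_ hlow (by positivity) ?_) hw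
    · refine Real.rpow_le_rpow hs.le ?_ (by linarith)
      nlinarith [a.2.1, a.2.2]
    · exact Real.rpow_nonneg (by nlinarith [a.2.1, a.2.2]) _
  have e : s ^ (α - 1) * (μ.real (Ici a) * (s * (2 * s) ^ (-(α + β + 1)))) =
      μ.real (Ici a) / (2 ^ (α + β + 1) * s ^ (β + 1)) := by
    have h1 : s ^ (α + β + 1) = s ^ (α - 1) * s * s ^ (β + 1) := by
      rw [← Real.rpow_add_one hs.ne', ← Real.rpow_add hs]
      ring_nf
    rw [Real.rpow_neg (by positivity), Real.mul_rpow (by norm_num) hs.le, h1]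
    have : s ^ (α - 1) ≠ 0 := (Real.rpow_pos_of_pos hs _).ne'
    field_simp
  rw [e, div_le_iff₀ (by positivity)] at hw1
  rw [← ofReal_measureReal]
  exact ENNReal.ofReal_le_ofReal (by linarith)

/-- Only tails near `1` matter: for `t ≤ r` the finite total mass is absorbed in the constant. The
summand `1` makes the constant strictly positive. -/
theorem isCarleson_of_tail {s C : ℝ} [IsFiniteMeasure μ] (hs : 0 ≤ s) (hC : 0 ≤ C)
    {r : Ico (0 : ℝ) 1}
    (h : ∀ t, r ≤ t → μ (Ici t) ≤ ENNReal.ofReal (C * (1 - (t : ℝ)) ^ s)) :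
    IsCarleson s μ := by
  have hr : 0 < 1 - (r : ℝ) := by linarith [r.2.2]
  have hD : 0 ≤ μ.real univ / (1 - (r : ℝ)) ^ s := by positivity
  refine ⟨C + μ.real univ / (1 - (r : ℝ)) ^ s + 1, by positivity, fun t => ?_⟩
  have ht : 0 < 1 - (t : ℝ) := by linarith [t.2.2]
  rcases le_total r t with hrt | hrt
  · refine (h t hrt).trans (ENNReal.ofReal_le_ofReal ?_)
    refine mul_le_mul_of_nonneg_right ?_ (by positivity)
    linarith
  · refine (measure_mono (subset_univ _)).trans ?_
    rw [← ofReal_measureReal]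
    refine ENNReal.ofReal_le_ofReal ?_
    have hrt' : (t : ℝ) ≤ r := hrt
    have h1 : (1 - (r : ℝ)) ^ s ≤ (1 - (t : ℝ)) ^ s :=
      Real.rpow_le_rpow hr.le (by linarith) hs
    have h2 : μ.real univ = μ.real univ / (1 - (r : ℝ)) ^ s * (1 - (r : ℝ)) ^ s := by
      field_simp
    exact h2.le.trans (mul_le_mul (by linarith) h1 (by positivity) (by positivity))

theorem IsVanishingCarleson.exists_tail_le {s ε : ℝ} (h : IsVanishingCarleson s μ)
    (hε : 0 < ε) : ∃ r : Ico (0 : ℝ) 1, ∀ t, r ≤ t →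
      μ (Ici t) ≤ ENNReal.ofReal (ε * (1 - (t : ℝ)) ^ s) := by
  have h1 := h.eventually (gt_mem_nhds (ENNReal.ofReal_pos.mpr hε))
  obtain ⟨l, hl, hsub⟩ := (mem_nhdsLT_iff_exists_Ioo_subset).mp h1
  have hl1 : l < 1 := hl
  refine ⟨⟨(max l 0 + 1) / 2, ?_, ?_⟩, fun t ht => ?_⟩
  · linarith [le_max_right l 0]
  · linarith [max_lt hl1 one_pos]
  · have ht' : (max l 0 + 1) / 2 ≤ (t : ℝ) := ht
    have hlt : l < t := by linarith [le_max_left l 0, max_lt hl1 one_pos]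
    have h2 : μ {x | (t : ℝ) ≤ (x : ℝ)} / ENNReal.ofReal ((1 - (t : ℝ)) ^ s) <
      ENNReal.ofReal ε := hsub ⟨hlt, t.2.2⟩
    have hp : 0 < (1 - (t : ℝ)) ^ s := Real.rpow_pos_of_pos (by linarith [t.2.2]) _
    rw [ENNReal.ofReal_mul hε.le]
    exact (ENNReal.div_le_iff (ENNReal.ofReal_pos.mpr hp).ne' ENNReal.ofReal_ne_top).mp h2.le

/-! ### Boundedness and compactness against the Carleson conditions. -/

theorem IntegralHilbertBounded.isCarleson (hα : 2 ≤ α) (hβ : 1 < β)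
    (hμ : ∫⁻ t : Ico (0 : ℝ) 1, ENNReal.ofReal (1 / (1 - (t : ℝ)) ^ (β - 1)) ∂μ < ⊤)
    (h : IntegralHilbertBounded μ α β (α - 1)) : IsCarleson (β + 1) μ := by
  have := isFiniteMeasure_of_lintegral hβ hμ
  obtain ⟨T, hT⟩ := h
  refine isCarleson_of_tail (C := 2 ^ (α + β + 1) * (‖T‖ * (1 + β * 2 ^ β)))
    (r := ⟨1 / 2, by norm_num, by norm_num⟩) (by linarith) (by positivity) fun t ht => ?_
  obtain ⟨f, hfn, hf⟩ := exists_testFunction (β := β) (by linarith) t.2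
  refine (hT.measure_tail_le hα hβ hμ ht hf).trans (ENNReal.ofReal_le_ofReal ?_)
  have h1 : ‖T f‖ ≤ ‖T‖ * (1 + β * 2 ^ β) := T.le_opNorm_of_le hfn
  have h2 : 0 ≤ 1 - (t : ℝ) := by linarith [t.2.2]
  gcongr

theorem IntegralHilbertCompact.isVanishingCarleson (hα : 2 ≤ α) (hβ : 1 < β)
    (hμ : ∫⁻ t : Ico (0 : ℝ) 1, ENNReal.ofReal (1 / (1 - (t : ℝ)) ^ (β - 1)) ∂μ < ⊤)
    (h : IntegralHilbertCompact μ α β (α - 1)) : IsVanishingCarleson (β + 1) μ := by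
  obtain ⟨T, hT, hTc⟩ := h
  -- The default `0` outside `[0,1)` keeps the norm bound valid for every real `a`.
  have hex : ∀ a : ℝ, ∃ f : BlochSpace β, ‖f‖ ≤ 1 + β * 2 ^ β ∧ (a ∈ Ico (0 : ℝ) 1 →
      ∀ z ∈ disc, f z = ((1 - a : ℝ) : ℂ) / (1 - (a : ℂ) * z) ^ (β : ℂ)) := by
    intro a
    by_cases ha : a ∈ Ico (0 : ℝ) 1
    · obtain ⟨f, h1, h2⟩ := exists_testFunction (β := β) (by linarith) ha
      exact ⟨f, h1, fun _ => h2⟩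
    · exact ⟨0, by rw [norm_zero]; positivity, fun h => absurd h ha⟩
  choose F hFn hF using hex
  have hβ' : 0 < β - 1 := by linarith
  have hpt : ∀ t : Ico (0 : ℝ) 1,
      Tendsto (fun a => F a ((t : ℝ) : ℂ)) (𝓝[<] 1) (𝓝 0) := by
    intro t
    have ht : 0 < 1 - (t : ℝ) := by linarith [t.2.2]
    have h1 : Tendsto (fun a : ℝ => (1 - a) * (1 - (t : ℝ)) ^ (-β)) (𝓝[<] 1) (𝓝 0) := by
      refine tendsto_nhdsWithin_of_tendsto_nhds ?_
      have : Continuous fun a : ℝ => (1 - a) * (1 - (t : ℝ)) ^ (-β) := by fun_prop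
      simpa using this.tendsto 1
    refine squeeze_zero_norm' ?_ h1
    filter_upwards [Ioo_mem_nhdsLT (zero_lt_one' ℝ)] with a ha
    rw [hF a ⟨ha.1.le, ha.2⟩ _ (ofReal_mem_disc t)]
    refine (norm_div_cpow_le _ (by linarith) ha.1.le ha.2
      (norm_ofReal_eq t.2.1).le t.2.2).trans ?_
    rw [norm_ofReal_eq (by linarith [ha.2])]
    refine mul_le_mul_of_nonneg_left ?_ (by linarith [ha.2])
    exact Real.rpow_le_rpow_of_nonpos ht (by nlinarith [t.2.1, ha.2]) (by linarith)
  have hTpt : ∀ z ∈ disc, Tendsto (fun a => T (F a) z) (𝓝[<] 1) (𝓝 0) := by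
    intro z hz
    have hz1 := mem_ball_zero_iff.mp hz
    have hlim : Tendsto (fun a => ∫ t : Ico (0 : ℝ) 1,
        F a ((t : ℝ) : ℂ) / (1 - ((t : ℝ) : ℂ) * z) ^ (α : ℂ) ∂μ) (𝓝[<] 1)
        (𝓝 (∫ _ : Ico (0 : ℝ) 1, (0 : ℂ) ∂μ)) := by
      refine tendsto_integral_filter_of_dominated_convergence
        (fun t => (1 + 1 / (β - 1)) * (1 + β * 2 ^ β) * (1 - (t : ℝ)) ^ (1 - β) *
          (1 - ‖z‖) ^ (-α)) (Eventually.of_forall fun a =>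
          (continuous_div_cpow (continuous_bloch_ofReal (F a)) _ hz).aestronglyMeasurable)
        (Eventually.of_forall fun a => ae_of_all _ fun t => ?_)
        (((integrable_rpow hμ).const_mul _).mul_const _) (ae_of_all _ fun t => ?_)
      · have h1 : 0 ≤ (1 - (t : ℝ)) ^ (1 - β) := Real.rpow_nonneg (by linarith [t.2.2]) _
        refine (norm_div_cpow_le _ (by linarith) t.2.1 t.2.2 le_rfl hz1).trans ?_
        refine mul_le_mul ?_ ?_ (Real.rpow_nonneg ?_ _) (by positivity)
        · refine (BlochSpace.norm_ofReal_apply_le hβ (F a) t.2.1 t.2.2).trans ?_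
          have := hFn a
          gcongr
        · exact Real.rpow_le_rpow_of_nonpos (by linarith)
            (by nlinarith [norm_nonneg z, t.2.2]) (by linarith)
        · nlinarith [norm_nonneg z, t.2.1, t.2.2]
      · simpa using (hpt t).div_const ((1 - ((t : ℝ) : ℂ) * z) ^ (α : ℂ))
    rw [integral_zero] at hlim
    exact hlim.congr fun a => ((hT (F a) z hz).2).symm
  -- All `T (F a)` lie in one compact set, and point evaluations are continuous, so the pointwise
  -- limit `0` is the only possible cluster point.
  have hTF : Tendsto (fun a => T (F a)) (𝓝[<] 1) (𝓝 0) := by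
    obtain ⟨Q, hQ, hsub⟩ := hTc.image_subset_compact_of_bounded
      (Metric.isBounded_closedBall (x := (0 : BlochSpace β)) (r := 1 + β * 2 ^ β))
    refine hQ.tendsto_nhds_of_unique_mapClusterPt (Eventually.of_forall fun a =>
      hsub ⟨F a, mem_closedBall_zero_iff.mpr (hFn a), rfl⟩) fun g _ hg => ?_
    refine BlochSpace.ext_disc fun z hz => ?_
    have hc := hg.continuousAt_comp
      (BlochSpace.continuous_apply (by linarith) hz).continuousAt
    exact @eq_of_nhds_neBot _ _ _ _ _ (hc.clusterPt.mono (hTpt z hz))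
  have hlim : Tendsto (fun a => ENNReal.ofReal (2 ^ (α + β + 1) * ‖T (F a)‖)) (𝓝[<] 1)
      (𝓝 0) := by
    have := ENNReal.tendsto_ofReal (hTF.norm.const_mul (2 ^ (α + β + 1)))
    simpa using this
  refine tendsto_of_tendsto_of_tendsto_of_le_of_le' tendsto_const_nhds hlim
    (Eventually.of_forall fun _ => zero_le) ?_
  filter_upwards [Ioo_mem_nhdsLT (show (1 / 2 : ℝ) < 1 by norm_num)] with a ha
  have ha0 : a ∈ Ico (0 : ℝ) 1 := ⟨by linarith [ha.1], ha.2⟩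
  have h1 := hT.measure_tail_le hα hβ hμ (a := ⟨a, ha0⟩) ha.1.le (hF a ha0)
  rw [ENNReal.ofReal_mul (by positivity)] at h1
  exact ENNReal.div_le_of_le_mul h1

theorem IsVanishingCarleson.integralHilbertCompact (hα : 2 ≤ α) (hβ : 1 < β)
    (hμ : ∫⁻ t : Ico (0 : ℝ) 1, ENNReal.ofReal (1 / (1 - (t : ℝ)) ^ (β - 1)) ∂μ < ⊤)
    (h : IsVanishingCarleson (β + 1) μ) : IntegralHilbertCompact μ α β (α - 1) := by
  have := isFiniteMeasure_of_lintegral hβ hμ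
  have hβ' : 0 < β - 1 := by linarith
  obtain ⟨r₁, hr₁⟩ := h.exists_tail_le one_pos
  obtain ⟨C, hC, hCμ⟩ := isCarleson_of_tail (by linarith) zero_le_one hr₁
  obtain ⟨T, hT⟩ := exists_isIntegralHilbert hα hβ hμ hC.le hCμ
  refine ⟨T, hT, ?_⟩
  rw [isCompactOperator_iff_exists_mem_nhds_image_subset_compact]
  -- The image of the closed ball is itself compact: an ultrafilter on it is lifted to the ball,
  -- where the Montel limit `g` stays, and `T g` is its limit.
  refine ⟨Metric.closedBall 0 1, Metric.closedBall_mem_nhds _ one_pos,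
    T '' Metric.closedBall 0 1, ?_, Subset.rfl⟩
  rw [isCompact_iff_ultrafilter_le_nhds]
  intro V hV
  have hVm : T '' Metric.closedBall 0 1 ∈ V := le_principal_iff.mp hV
  set U := Ultrafilter.ofComapInfPrincipal hVm
  have hU : ∀ᶠ f in (U : Filter (BlochSpace β)), ‖f‖ ≤ 1 := by
    filter_upwards [Ultrafilter.ofComapInfPrincipal_mem hVm] with f hf
    exact mem_closedBall_zero_iff.mp hf
  obtain ⟨g, hg, hlim⟩ := BlochSpace.exists_limit_of_ultrafilter (by linarith) U hU
  refine ⟨T g, ⟨g, mem_closedBall_zero_iff.mpr hg, rfl⟩, ?_⟩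
  have hmap : (V : Filter (BlochSpace (α - 1))) = Filter.map T U := by
    rw [← Ultrafilter.ofComapInfPrincipal_eq_of_map hVm]
    rfl
  rw [hmap]
  change Tendsto T U (𝓝 (T g))
  rw [Metric.tendsto_nhds]
  intro ε hε
  -- `A` and `B` collect the factors of `δ` and `K` in the norm bound for `f - g`, whose norm is at
  -- most `2`, so each part contributes at most `ε/3`. The `+ 1` in `A` keeps it positive when `μ =
  -- 0`.
  set D := 1 + α * 2 ^ (α - 1) with hD
  have hα0 : 0 < α := by linarith
  have hD0 : 0 < D := by positivity
  set B := D * ((1 + 1 / (β - 1)) * 2 * 2 ^ (β + 3)) with hB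
  have hB0 : 0 < B := by positivity
  obtain ⟨r, hr⟩ := h.exists_tail_le (div_pos hε (mul_pos three_pos hB0))
  have hr1 : 0 < 1 - (r : ℝ) := by linarith [r.2.2]
  set A := D * ((1 - (r : ℝ)) ^ (-α - 1) * μ.real univ) + 1 with hA
  have hA0 : 0 < A := by positivity
  have hunif := Metric.tendstoUniformlyOn_iff.mp
    ((tendstoLocallyUniformlyOn_iff_forall_isCompact Metric.isOpen_ball).mp hlim
      (Metric.closedBall 0 r) (Metric.closedBall_subset_ball r.2.2) (isCompact_closedBall _ _))
    (ε / (3 * A)) (by positivity)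
  filter_upwards [hunif, hU] with f hf hf1
  have hb := hT.norm_le hα hβ hμ (K := ε / (3 * B)) (δ := ε / (3 * A)) (M := 2)
    (by positivity) (by positivity) (by norm_num) (f - g) hr (fun t ht => by
      have := hf ((t : ℝ) : ℂ) (by
        rw [mem_closedBall_zero_iff, norm_ofReal_eq t.2.1]
        exact (Subtype.coe_lt_coe.mpr ht).le)
      rw [dist_comm, dist_eq_norm] at this
      exact this.le) (by linarith [norm_sub_le f g])
  rw [dist_eq_norm, ← map_sub]
  refine hb.trans_lt ?_
  have e : D * (ε / (3 * A) * (1 - (r : ℝ)) ^ (-α - 1) * μ.real univ +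
      (1 + 1 / (β - 1)) * 2 * (2 ^ (β + 3) * (ε / (3 * B)))) =
      (A - 1) * (ε / (3 * A)) + B * (ε / (3 * B)) := by
    rw [hA, hB]
    ring
  rw [e, sub_mul, one_mul]
  have e1 : A * (ε / (3 * A)) = ε / 3 := by field_simp
  have e2 : B * (ε / (3 * B)) = ε / 3 := by field_simp
  have e3 : 0 < ε / (3 * A) := by positivity
  rw [e1, e2]
  linarith

end Transform
end

theorem theorem2p7 (α β : ℝ) (hα : 2 ≤ α) (hβ : 1 < β) (μ : Measure (Ico (0 : ℝ) 1))
    (hμ : ∫⁻ t : Ico (0 : ℝ) 1, ENNReal.ofReal (1 / (1 - (t : ℝ)) ^ (β - 1)) ∂μ < ⊤) :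
    (IntegralHilbertBounded μ α β (α - 1) ↔ IsCarleson (β + 1) μ) ∧
    (IntegralHilbertCompact μ α β (α - 1) ↔ IsVanishingCarleson (β + 1) μ) := by
  refine ⟨⟨fun h => h.isCarleson hα hβ hμ, ?_⟩, ⟨fun h => h.isVanishingCarleson hα hβ hμ,
    fun h => h.integralHilbertCompact hα hβ hμ⟩⟩
  rintro ⟨C, hC, hCμ⟩
  exact exists_isIntegralHilbert hα hβ hμ hC.le hCμ
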